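/- Let $n_X,n_Y\ge 1$, let $S$ be a homogeneous polynomial on $\mathbb R^{n_X}\times\mathbb R^{n_Y}$ with real coefficients, of degree $d>n_X+n_Y$, satisfying the rank one condition: the system $\partial_{x_i}\partial_{y_j}S(x,y)=0$ ($1\le i\le n_X$, $1\le j\le n_Y$) has no solution $(x,y)\neq(0,0)$. Let $D$ be a homogeneous polynomial on $\mathbb R^{n_X}\times\mathbb R^{n_Y}$ with real coefficients, of degree $d_D\ge 1$, that does not vanish away from the origin, and let $\varphi\in C_c^\infty(\mathbb R^{n_X}\times\mathbb R^{n_Y})$. For real $\lambda\ne0$ and $z\in\mathbb C$ put $$W_{\lambda,D}^zf(x)=\int_{\mathbb R^{n_Y}}e^{i\lambda S(x,y)}|D(x,y)|^z\varphi(x,y)f(y)\,dy,$$ let $\sigma_0=\frac{d-n_X-n_Y}{2d_D}$, and let $\|\cdot\|_2$ be the operator norm from $L^2(\mathbb R^{n_Y})$ to $L^2(\mathbb R^{n_X})$. Then for all $\delta>0$ and $M\in\mathbb R$ there is a constant $C=C(S,D,\varphi,\delta,M)$, independent of $\lambda$ and $z$, such that for all real $\lambda\neq0$ and all $z\in\mathbb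 C$ the operator $W^z_{\lambda,D}$ is well defined (for $f\in L^2(\mathbb R^{n_Y})$ the integral converges absolutely for almost every $x$) and bounded, with $$\|W_{\lambda,D}^z\|_2\le C(1+|z|)^2\begin{cases}|\lambda|^{-1/2}, & \sigma_0+\delta\le\operatorname{Re}z\le M,\\ |\lambda|^{-1/2}\log(2+|\lambda|), & \operatorname{Re}z=\sigma_0,\\ |\lambda|^{-\frac{d_D}{d}\operatorname{Re}z-\frac{n_X+n_Y}{2d}}, & -\frac{\min\{n_X,n_Y\}}{d_D}<\operatorname{Re}z\le\sigma_0-\delta,\end{cases}$$ whenever $\operatorname{Re} z$ lies in one of these three ranges. In particular the three bounds hold for all $z$ with $\operatorname{Re}z>\sigma_0$, $\operatorname{Re}z=\sigma_0$, and $-\min\{n_X,n_Y\}/d_D<\operatorname{Re}z<\sigma_0$ respectively, with a constant that depends on $z$ only through $\operatorname{Re}z$. -/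

import Mathlib

open MeasureTheory
open scoped ContDiff

noncomputable section

namespace DampedOIO

/-- The value at `(x, y) ∈ ℝ^{n_X} × ℝ^{n_Y}` of a real polynomial in the variables
`x_i` (`Sum.inl i`) and `y_j` (`Sum.inr j`). -/
def polyEval {nX nY : ℕ} (P : MvPolynomial (Fin nX ⊕ Fin nY) ℝ)
    (x : Fin nX → ℝ) (y : Fin nY → ℝ) : ℝ :=
  MvPolynomial.eval (Sum.elim x y) P

/-- The rank one condition: the system `∂_{x_i} ∂_{y_j} S (x, y) = 0` (all `i`, `j`) has no
solution other than the origin. -/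
def RankOne {nX nY : ℕ} (S : MvPolynomial (Fin nX ⊕ Fin nY) ℝ) : Prop :=
  ∀ (x : Fin nX → ℝ) (y : Fin nY → ℝ),
    (∀ (i : Fin nX) (j : Fin nY),
      polyEval (MvPolynomial.pderiv (Sum.inl i) (MvPolynomial.pderiv (Sum.inr j) S)) x y = 0) →
    x = 0 ∧ y = 0

/-- `P` has no real zero other than the origin. -/
def NonvanishingAwayFromOrigin {nX nY : ℕ} (P : MvPolynomial (Fin nX ⊕ Fin nY) ℝ) : Prop :=
  ∀ (x : Fin nX → ℝ) (y : Fin nY → ℝ), polyEval P x y = 0 → x = 0 ∧ y = 0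

/-- The kernel `e^{iλS(x,y)} |D(x,y)|^z φ(x,y)`. -/
def dampedKernel {nX nY : ℕ} (S D : MvPolynomial (Fin nX ⊕ Fin nY) ℝ)
    (φ : (Fin nX → ℝ) × (Fin nY → ℝ) → ℂ) (lam : ℝ) (z : ℂ)
    (x : Fin nX → ℝ) (y : Fin nY → ℝ) : ℂ :=
  Complex.exp (Complex.I * ((lam * polyEval S x y : ℝ) : ℂ)) *
    ((|polyEval D x y| : ℝ) : ℂ) ^ z * φ (x, y)

/-- The damped oscillatory integral operator
`f ↦ (x ↦ ∫ e^{iλS(x,y)} |D(x,y)|^z φ(x,y) f(y) dy)`. -/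
def dampedOp {nX nY : ℕ} (S D : MvPolynomial (Fin nX ⊕ Fin nY) ℝ)
    (φ : (Fin nX → ℝ) × (Fin nY → ℝ) → ℂ) (lam : ℝ) (z : ℂ)
    (f : (Fin nY → ℝ) → ℂ) (x : Fin nX → ℝ) : ℂ :=
  ∫ y, dampedKernel S D φ lam z x y * f y

/-- The damped operator is well defined and bounded from `L²(ℝ^{n_Y})` to `L²(ℝ^{n_X})` (Lebesgue
measure), with operator norm at most `A`: for every `f ∈ L²` the defining integral converges
absolutely for almost every `x`, the resulting function is in `L²`, and its norm is at most
`A` times that of `f`. -/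
def DampedNormLE {nX nY : ℕ} (S D : MvPolynomial (Fin nX ⊕ Fin nY) ℝ)
    (φ : (Fin nX → ℝ) × (Fin nY → ℝ) → ℂ) (lam : ℝ) (z : ℂ) (A : ℝ) : Prop :=
  ∀ f : (Fin nY → ℝ) → ℂ, MemLp f 2 volume →
    (∀ᵐ x : Fin nX → ℝ, Integrable (fun y => dampedKernel S D φ lam z x y * f y)) ∧
    MemLp (dampedOp S D φ lam z f) 2 volume ∧
    eLpNorm (dampedOp S D φ lam z f) 2 volume ≤ ENNReal.ofReal A * eLpNorm f 2 volume

/-- The critical exponent `(d - n_X - n_Y) / (2 d_D)`. -/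
def critExp (nX nY d dD : ℕ) : ℝ := ((d : ℝ) - nX - nY) / (2 * dD)

end DampedOIO

end

/-!
Suppose `∂_{x_i} ∂_{y_j} S ≠ 0` at some point. Near it, restrict the operator to lines in the
directions `e_i` and `e_j`: the kernel of `T T*` at `(t, t')` is an oscillatory integral whose phase
has derivative comparable to `λ (t - t')`, so two integrations by parts and Schur's test give the
bound `|λ|^{-1/2}`. By the rank one condition and compactness the same bound holds for amplitudes
supported in an annulus. Homogeneity turns the shell `|(x, y)| ∼ r` into that annulus with `λ`
replaced by `λ r^d`, so the shell contributes `|λ|^{-1/2} r^β` with `β = d_D (Re z - σ₀)`, while the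
ball `|(x, y)| ≤ r` contributes `r^{β + d/2}` by the size of the kernel alone. Summing the dyadic
shells down to `r ∼ |λ|^{-1/d}`, where the two bounds agree, gives the three cases according to
whether `β` is positive, zero or negative.
-/

noncomputable section

namespace DampedOIO

open Set Filter
open scoped ENNReal ComplexConjugate Topology

section Kernel

section Lintegral

variable {X Y : Type*} [MeasurableSpace X] [MeasurableSpace Y]

theorem lintegral_mul_sq_le (μ : Measure X) {f g : X → ℝ≥0∞} (hf : AEMeasurable f μ)
    (hg : AEMeasurable g μ) :
    (∫⁻ x, f x * g x ∂μ) ^ 2 ≤ (∫⁻ x, f x ^ 2 ∂μ) * ∫⁻ x, g x ^ 2 ∂μ := by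
  have h := ENNReal.lintegral_mul_le_Lp_mul_Lq μ Real.HolderConjugate.two_two hf hg
  simp only [Pi.mul_apply, ENNReal.rpow_two] at h
  have sqrt_sq : ∀ a : ℝ≥0∞, (a ^ (1 / 2 : ℝ)) ^ 2 = a := fun a => by
    rw [← ENNReal.rpow_natCast, ← ENNReal.rpow_mul]; norm_num
  simpa only [mul_pow, sqrt_sq] using pow_le_pow_left₀ zero_le h 2

theorem lintegral_mul_sq_le_weighted (ν : Measure Y) {k w f : Y → ℝ≥0∞} (hk : Measurable k)
    (hw : Measurable w) (hw0 : ∀ᵐ y ∂ν, w y ≠ 0 ∧ w y ≠ ⊤) (hf : Measurable f) :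
    (∫⁻ y, k y * f y ∂ν) ^ 2 ≤ (∫⁻ y, k y * w y ∂ν) * ∫⁻ y, k y * ((w y)⁻¹ * f y ^ 2) ∂ν := by
  have sqrt_sq : ∀ a : ℝ≥0∞, (a ^ (1 / 2 : ℝ)) ^ 2 = a := fun a => by
    rw [← ENNReal.rpow_natCast, ← ENNReal.rpow_mul]; norm_num
  have split : ∫⁻ y, k y * f y ∂ν =
      ∫⁻ y, (k y * w y) ^ (1 / 2 : ℝ) * ((k y * (w y)⁻¹) ^ (1 / 2 : ℝ) * f y) ∂ν := by
    refine lintegral_congr_ae ?_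
    filter_upwards [hw0] with y hy
    have hsq : k y * w y * (k y * (w y)⁻¹) = k y ^ (2 : ℝ) := by
      rw [ENNReal.rpow_two, mul_mul_mul_comm, ENNReal.mul_inv_cancel hy.1 hy.2, mul_one, sq]
    rw [← mul_assoc, ← ENNReal.mul_rpow_of_nonneg _ _ (by norm_num), hsq, ← ENNReal.rpow_mul]
    norm_num
  rw [split]
  refine (lintegral_mul_sq_le ν ((hk.mul hw).pow_const _).aemeasurable
    (((hk.mul hw.inv).pow_const _).mul hf).aemeasurable).trans_eq ?_
  simp only [Pi.mul_apply, Pi.inv_apply, mul_pow, sqrt_sq, mul_assoc]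

theorem lintegral_schur_test (μ : Measure X) (ν : Measure Y) [SFinite μ] [SFinite ν]
    {K : X → Y → ℝ≥0∞} (hK : Measurable (Function.uncurry K))
    {v : X → ℝ≥0∞} (hv : Measurable v) {w : Y → ℝ≥0∞} (hw : Measurable w)
    (hw0 : ∀ᵐ y ∂ν, w y ≠ 0 ∧ w y ≠ ⊤) {A B : ℝ≥0∞}
    (hA : ∀ᵐ x ∂μ, ∫⁻ y, K x y * w y ∂ν ≤ A * v x)
    (hB : ∀ᵐ y ∂ν, ∫⁻ x, K x y * v x ∂μ ≤ B * w y)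
    {f : Y → ℝ≥0∞} (hf : Measurable f) :
    ∫⁻ x, (∫⁻ y, K x y * f y ∂ν) ^ 2 ∂μ ≤ A * B * ∫⁻ y, f y ^ 2 ∂ν := by
  have hKx : ∀ x, Measurable (K x) := fun x => hK.comp measurable_prodMk_left
  have hKy : ∀ y, Measurable fun x => K x y := fun y => hK.comp measurable_prodMk_right
  have hg : Measurable fun y => (w y)⁻¹ * f y ^ 2 := hw.inv.mul (hf.pow_const 2)
  calc ∫⁻ x, (∫⁻ y, K x y * f y ∂ν) ^ 2 ∂μ
      ≤ ∫⁻ x, A * v x * ∫⁻ y, K x y * ((w y)⁻¹ * f y ^ 2) ∂ν ∂μ := by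
        refine lintegral_mono_ae ?_
        filter_upwards [hA] with x hx
        exact (lintegral_mul_sq_le_weighted ν (hKx x) hw hw0 hf).trans (mul_le_mul_left hx _)
    _ = ∫⁻ x, ∫⁻ y, A * v x * (K x y * ((w y)⁻¹ * f y ^ 2)) ∂ν ∂μ :=
        lintegral_congr fun x => (lintegral_const_mul (A * v x) ((hKx x).mul hg)).symm
    _ = ∫⁻ y, ∫⁻ x, A * v x * (K x y * ((w y)⁻¹ * f y ^ 2)) ∂μ ∂ν :=
        lintegral_lintegral_swap (((hv.comp measurable_fst).const_mul A).mul
          (hK.mul (hg.comp measurable_snd))).aemeasurable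
    _ = ∫⁻ y, A * ((w y)⁻¹ * f y ^ 2) * ∫⁻ x, K x y * v x ∂μ ∂ν := by
        refine lintegral_congr fun y => ?_
        rw [← lintegral_const_mul (f := fun x => K x y * v x) _ ((hKy y).mul hv)]
        exact lintegral_congr fun x => by ring
    _ ≤ ∫⁻ y, A * B * f y ^ 2 ∂ν := by
        refine lintegral_mono_ae ?_
        filter_upwards [hB, hw0] with y hy hy0
        calc A * ((w y)⁻¹ * f y ^ 2) * ∫⁻ x, K x y * v x ∂μ
            ≤ A * ((w y)⁻¹ * f y ^ 2) * (B * w y) := by gcongr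
          _ = A * B * f y ^ 2 * (w y * (w y)⁻¹) := by ring
          _ = A * B * f y ^ 2 := by rw [ENNReal.mul_inv_cancel hy0.1 hy0.2, mul_one]
    _ = A * B * ∫⁻ y, f y ^ 2 ∂ν := lintegral_const_mul _ (hf.pow_const 2)

theorem eLpNorm_two_sq {E : Type*} [NormedAddCommGroup E] (μ : Measure X) (f : X → E) :
    eLpNorm f 2 μ ^ 2 = ∫⁻ x, ‖f x‖ₑ ^ 2 ∂μ := by
  simpa using eLpNorm_nnreal_pow_eq_lintegral (μ := μ) (f := f) (p := 2) two_ne_zero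

theorem eLpNorm_two_le_mul_iff {E F : Type*} [NormedAddCommGroup E] [NormedAddCommGroup F]
    {μ : Measure X} {ν : Measure Y} {f : X → E} {g : Y → F} {A : ℝ≥0∞} :
    eLpNorm f 2 μ ≤ A * eLpNorm g 2 ν ↔
      ∫⁻ x, ‖f x‖ₑ ^ 2 ∂μ ≤ A ^ 2 * ∫⁻ y, ‖g y‖ₑ ^ 2 ∂ν := by
  rw [← eLpNorm_two_sq, ← eLpNorm_two_sq, ← mul_pow,
    (ENNReal.pow_right_strictMono two_ne_zero).le_iff_le]

theorem eLpNorm_two_comp_measurableEquiv {μ : Measure X} {ν : Measure Y} (e : X ≃ᵐ Y) {c : ℝ}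
    (hc : 0 < c) (he : μ.map e = ENNReal.ofReal c • ν) (f : Y → ℂ) :
    eLpNorm (f ∘ e) 2 μ = ENNReal.ofReal √c * eLpNorm f 2 ν := by
  rw [← e.measurableEmbedding.eLpNorm_map_measure, he,
    eLpNorm_smul_measure_of_ne_top ENNReal.ofNat_ne_top, smul_eq_mul, Real.sqrt_eq_rpow,
    ENNReal.ofReal_rpow_of_nonneg hc.le (by norm_num)]
  norm_num

theorem memLp_two_comp_measurableEquiv_iff {μ : Measure X} {ν : Measure Y} (e : X ≃ᵐ Y) {c : ℝ}
    (hc : 0 < c) (he : μ.map e = ENNReal.ofReal c • ν) {f : Y → ℂ} :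
    MemLp (f ∘ e) 2 μ ↔ MemLp f 2 ν := by
  rw [← e.memLp_map_measure_iff, he]
  refine ⟨fun h => h.of_measure_le_smul (c := (ENNReal.ofReal c)⁻¹) (by simpa using hc) ?_,
    fun h => h.smul_measure ENNReal.ofReal_ne_top⟩
  rw [smul_smul, ENNReal.inv_mul_cancel (by simpa using hc) ENNReal.ofReal_ne_top, one_smul]

end Lintegral

variable {X Y : Type*} [MeasureSpace X] [MeasureSpace Y]

/-- The integral operator `f ↦ ∫ K(·, y) f(y) dy` is defined by almost everywhere absolutely
convergent integrals on `L²(Y)` and maps it to `L²(X)` with operator norm at most `A`. -/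
def KernelNormLE (K : X → Y → ℂ) (A : ℝ) : Prop :=
  ∀ f : Y → ℂ, MemLp f 2 volume →
    (∀ᵐ x : X, Integrable fun y => K x y * f y) ∧
    MemLp (fun x => ∫ y, K x y * f y) 2 volume ∧
    eLpNorm (fun x => ∫ y, K x y * f y) 2 volume ≤ ENNReal.ofReal A * eLpNorm f 2 volume

namespace KernelNormLE

variable {K L : X → Y → ℂ} {A B : ℝ}

theorem mono (h : KernelNormLE K A) (hAB : A ≤ B) : KernelNormLE K B := fun f hf =>
  ⟨(h f hf).1, (h f hf).2.1, (h f hf).2.2.trans (by gcongr)⟩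

theorem lintegral_sq_le (h : KernelNormLE K A) {f : Y → ℂ} (hf : MemLp f 2 volume) :
    ∫⁻ x, ‖∫ y, K x y * f y‖ₑ ^ 2 ≤ ENNReal.ofReal A ^ 2 * ∫⁻ y, ‖f y‖ₑ ^ 2 :=
  eLpNorm_two_le_mul_iff.1 (h f hf).2.2

theorem zero : KernelNormLE (fun (_ : X) (_ : Y) => (0 : ℂ)) 0 := fun f _ => by
  simp

theorem const_mul (h : KernelNormLE K A) (c : ℂ) :
    KernelNormLE (fun x y => c * K x y) (‖c‖ * A) := fun f hf => by
  obtain ⟨hint, hmem, hle⟩ := h f hf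
  simp only [mul_assoc, integral_const_mul]
  refine ⟨hint.mono fun x hx => hx.const_mul c, hmem.const_mul c, ?_⟩
  calc eLpNorm (fun x => c * ∫ y, K x y * f y) 2 volume
      = ‖c‖ₑ * eLpNorm (fun x => ∫ y, K x y * f y) 2 volume := eLpNorm_const_smul c _ 2 volume
    _ ≤ ‖c‖ₑ * (ENNReal.ofReal A * eLpNorm f 2 volume) := by gcongr
    _ = ENNReal.ofReal (‖c‖ * A) * eLpNorm f 2 volume := by
      rw [ENNReal.ofReal_mul (norm_nonneg c), ofReal_norm, mul_assoc]

theorem add (hK : KernelNormLE K A) (hL : KernelNormLE L B) (hA : 0 ≤ A) (hB : 0 ≤ B) :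
    KernelNormLE (fun x y => K x y + L x y) (A + B) := fun f hf => by
  obtain ⟨hKi, hKm, hKA⟩ := hK f hf
  obtain ⟨hLi, hLm, hLB⟩ := hL f hf
  have hadd : (fun x => ∫ y, (K x y + L x y) * f y) =ᵐ[volume]
      (fun x => ∫ y, K x y * f y) + fun x => ∫ y, L x y * f y := by
    filter_upwards [hKi, hLi] with x h1 h2
    simpa only [add_mul, Pi.add_apply] using integral_add h1 h2
  refine ⟨?_, (memLp_congr_ae hadd).2 (hKm.add hLm), ?_⟩
  · filter_upwards [hKi, hLi] with x h1 h2
    simp only [add_mul]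
    exact h1.add h2
  · rw [eLpNorm_congr_ae hadd, ENNReal.ofReal_add hA hB, add_mul]
    exact (eLpNorm_add_le hKm.1 hLm.1 one_le_two).trans (add_le_add hKA hLB)

theorem sum {ι : Type*} (s : Finset ι) {K : ι → X → Y → ℂ} {A : ι → ℝ}
    (hK : ∀ i ∈ s, KernelNormLE (K i) (A i)) (hA : ∀ i ∈ s, 0 ≤ A i) :
    KernelNormLE (fun x y => ∑ i ∈ s, K i x y) (∑ i ∈ s, A i) := by
  classical
  induction s using Finset.induction_on with
  | empty => simpa using zero
  | insert a s ha ih =>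
    simp only [Finset.sum_insert ha]
    rw [Finset.forall_mem_insert] at hK hA
    exact hK.1.add (ih hK.2 hA.2) hA.1 (Finset.sum_nonneg hA.2)

theorem of_measurable [SFinite (volume : Measure Y)] (hK : Measurable (Function.uncurry K))
    (h : ∀ f : Y → ℂ, Measurable f → MemLp f 2 volume →
      (∀ᵐ x : X, Integrable fun y => K x y * f y) ∧
      ∫⁻ x, ‖∫ y, K x y * f y‖ₑ ^ 2 ≤ ENNReal.ofReal A ^ 2 * ∫⁻ y, ‖f y‖ₑ ^ 2) :
    KernelNormLE K A := fun f hf => by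
  obtain ⟨g, hg, hfg⟩ := hf.1
  have hgm : Measurable g := hg.measurable
  have hg2 : MemLp g 2 volume := (memLp_congr_ae hfg).1 hf
  have hKfg : ∀ x, (fun y => K x y * f y) =ᵐ[volume] fun y => K x y * g y := fun x => by
    filter_upwards [hfg] with y hy
    rw [hy]
  obtain ⟨hint, hle⟩ := h g hgm hg2
  simp only [fun x => integrable_congr (hKfg x), fun x => integral_congr_ae (hKfg x),
    eLpNorm_congr_ae hfg]
  have hle := eLpNorm_two_le_mul_iff.2 hle
  have hmeas : StronglyMeasurable fun x => ∫ y, K x y * g y :=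
    (hK.mul (hgm.comp measurable_snd)).stronglyMeasurable.integral_prod_right
  exact ⟨hint, ⟨hmeas.aestronglyMeasurable,
    hle.trans_lt (ENNReal.mul_lt_top ENNReal.ofReal_lt_top hg2.2)⟩, hle⟩

theorem of_lintegral_sq_le [SFinite (volume : Measure Y)]
    (hK : Measurable (Function.uncurry K))
    (h : ∀ f : Y → ℝ≥0∞, Measurable f →
      ∫⁻ x, (∫⁻ y, ‖K x y‖ₑ * f y) ^ 2 ≤ ENNReal.ofReal A ^ 2 * ∫⁻ y, f y ^ 2) :
    KernelNormLE K A := by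
  refine of_measurable hK fun f hf hf2 => ⟨?_, ?_⟩
  · have hfin : ∫⁻ x, (∫⁻ y, ‖K x y‖ₑ * ‖f y‖ₑ) ^ 2 ≠ ⊤ := by
      refine ne_top_of_le_ne_top ?_ (h _ hf.enorm)
      rw [← eLpNorm_two_sq]
      exact ENNReal.mul_ne_top (ENNReal.pow_ne_top ENNReal.ofReal_ne_top)
        (ENNReal.pow_ne_top hf2.eLpNorm_ne_top)
    have hmeas : Measurable fun x => (∫⁻ y, ‖K x y‖ₑ * ‖f y‖ₑ) ^ 2 :=
      (hK.enorm.mul (hf.enorm.comp measurable_snd)).lintegral_prod_right.pow_const 2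
    filter_upwards [ae_lt_top hmeas hfin] with x hx
    refine ⟨((hK.comp measurable_prodMk_left).mul hf).aestronglyMeasurable, ?_⟩
    simpa only [HasFiniteIntegral, enorm_mul] using (ENNReal.pow_lt_top_iff.1 hx).resolve_right
      two_ne_zero
  · refine (lintegral_mono fun x => ?_).trans (h _ hf.enorm)
    gcongr
    simpa only [enorm_mul] using enorm_integral_le_lintegral_enorm fun y => K x y * f y

theorem of_schur [SFinite (volume : Measure X)] [SFinite (volume : Measure Y)]
    (hK : Measurable (Function.uncurry K))
    {v : X → ℝ≥0∞} (hv : Measurable v) {w : Y → ℝ≥0∞} (hw : Measurable w)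
    (hw0 : ∀ᵐ y : Y, w y ≠ 0 ∧ w y ≠ ⊤)
    (hA : ∀ᵐ x : X, ∫⁻ y, ‖K x y‖ₑ * w y ≤ ENNReal.ofReal A * v x)
    (hB : ∀ᵐ y : Y, ∫⁻ x, ‖K x y‖ₑ * v x ≤ ENNReal.ofReal A * w y) : KernelNormLE K A :=
  of_lintegral_sq_le hK fun f hf => by
    simpa only [sq (ENNReal.ofReal A)] using
      lintegral_schur_test volume volume (K := fun x y => ‖K x y‖ₑ) hK.enorm hv hw hw0 hA hB hf

/-- Change of variables: `a` and `b` are the reciprocals of the Jacobians of `eX` and `eY`. -/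
theorem of_measurableEquiv {X' Y' : Type*} [MeasureSpace X'] [MeasureSpace Y']
    (eX : X' ≃ᵐ X) (eY : Y' ≃ᵐ Y) {a b : ℝ} (ha : 0 < a) (hb : 0 < b)
    (hX : (volume : Measure X').map eX = ENNReal.ofReal a • volume)
    (hY : (volume : Measure Y').map eY = ENNReal.ofReal b • volume)
    (h : KernelNormLE (fun x y => K (eX x) (eY y)) A) :
    KernelNormLE K ((√(a * b))⁻¹ * A) := fun f hf => by
  have hb0 : ENNReal.ofReal b ≠ 0 := by simpa using hb
  obtain ⟨hint, hmem, hle⟩ := h (f ∘ eY) ((memLp_two_comp_measurableEquiv_iff eY hb hY).2 hf)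
  have hint_iff : ∀ x, Integrable (fun y => K x (eY y) * (f ∘ eY) y) ↔
      Integrable fun y => K x y * f y := fun x => by
    rw [← integrable_smul_measure (f := fun y => K x y * f y) hb0 ENNReal.ofReal_ne_top, ← hY,
      integrable_map_equiv]
    rfl
  have hchange : (fun x => ∫ y, K (eX x) (eY y) * (f ∘ eY) y) =
      (b : ℂ) • ((fun x => ∫ y, K x y * f y) ∘ eX) := funext fun x => by
    have := integral_map_equiv (μ := volume) eY fun y => K (eX x) y * f y
    rw [hY, integral_smul_measure, ENNReal.toReal_ofReal hb.le] at this
    exact this.symm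
  rw [hchange] at hmem hle
  refine ⟨?_, (memLp_two_comp_measurableEquiv_iff eX ha hX).1 ?_, ?_⟩
  · simp only [hint_iff] at hint
    have hint_map : ∀ᵐ x ∂(volume : Measure X').map eX, Integrable fun y => K x y * f y :=
      eX.measurableEmbedding.ae_map_iff.2 hint
    rwa [hX, Measure.ae_ennreal_smul_measure_iff (by simpa using ha)] at hint_map
  · simpa only [inv_smul_smul₀ (Complex.ofReal_ne_zero.2 hb.ne')] using hmem.const_smul (b : ℂ)⁻¹
  · rw [eLpNorm_const_smul, eLpNorm_two_comp_measurableEquiv eX ha hX, ← ofReal_norm,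
      eLpNorm_two_comp_measurableEquiv eY hb hY, Complex.norm_of_nonneg hb.le] at hle
    set N := eLpNorm (fun x => ∫ y, K x y * f y) 2 volume
    have hjac : (√(a * b))⁻¹ * (√b)⁻¹ * (b * √a) = 1 := by
      rw [Real.sqrt_mul ha.le]
      field_simp
      exact (Real.sq_sqrt hb.le).symm
    calc N = ENNReal.ofReal ((√(a * b))⁻¹ * (√b)⁻¹) *
            (ENNReal.ofReal b * (ENNReal.ofReal √a * N)) := by
          rw [← mul_assoc (ENNReal.ofReal b), ← mul_assoc, ← ENNReal.ofReal_mul hb.le,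
            ← ENNReal.ofReal_mul (by positivity), hjac, ENNReal.ofReal_one, one_mul]
      _ ≤ ENNReal.ofReal ((√(a * b))⁻¹ * (√b)⁻¹) *
          (ENNReal.ofReal A * (ENNReal.ofReal √b * eLpNorm f 2 volume)) := by gcongr
      _ = ENNReal.ofReal ((√(a * b))⁻¹ * (√b)⁻¹ * √b) * ENNReal.ofReal A *
          eLpNorm f 2 volume := by
          rw [ENNReal.ofReal_mul (q := √b) (by positivity)]; ring
      _ = ENNReal.ofReal ((√(a * b))⁻¹ * A) * eLpNorm f 2 volume := by
          rw [inv_mul_cancel_right₀ (by positivity), ← ENNReal.ofReal_mul (by positivity)]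

end KernelNormLE

end Kernel

section Homogeneous

theorem map_smul_volume_pi {n : ℕ} {r : ℝ} (hr : 0 < r) :
    (volume : Measure (Fin n → ℝ)).map (r • ·) = ENNReal.ofReal (r ^ n)⁻¹ • volume := by
  rw [Measure.map_addHaar_smul volume hr.ne', Module.finrank_fin_fun, abs_of_pos (by positivity)]

theorem lintegral_eq_mul_lintegral_smul {n : ℕ} {r : ℝ} (hr : 0 < r)
    {f : (Fin n → ℝ) → ℝ≥0∞} (hf : Measurable f) :
    ∫⁻ x, f x = ENNReal.ofReal (r ^ n) * ∫⁻ u, f (r • u) := by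
  rw [← lintegral_map hf (measurable_const_smul r), map_smul_volume_pi hr, lintegral_smul_measure,
    smul_eq_mul, ← mul_assoc, ← ENNReal.ofReal_mul (by positivity), mul_inv_cancel₀ (by positivity),
    ENNReal.ofReal_one, one_mul]

theorem KernelNormLE.of_comp_smul {m n : ℕ} {r : ℝ} (hr : 0 < r)
    {K : (Fin m → ℝ) → (Fin n → ℝ) → ℂ} {A : ℝ}
    (h : KernelNormLE (fun x y => K (r • x) (r • y)) A) :
    KernelNormLE K (r ^ (((m : ℝ) + n) / 2) * A) := by
  have hjac : (√((r ^ m)⁻¹ * (r ^ n)⁻¹))⁻¹ = r ^ (((m : ℝ) + n) / 2) := by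
    rw [← mul_inv, ← pow_add, Real.sqrt_inv, inv_inv, Real.sqrt_eq_rpow, ← Real.rpow_natCast,
      ← Real.rpow_mul hr.le]
    push_cast
    congr 1
    ring
  rw [← hjac]
  exact h.of_measurableEquiv (MeasurableEquiv.smul₀ r hr.ne') (MeasurableEquiv.smul₀ r hr.ne')
    (by positivity) (by positivity) (map_smul_volume_pi hr) (map_smul_volume_pi hr)

theorem integrable_max_rpow_mul_rpow {n : ℕ} (hn : 0 < n) {m : ℝ} (hm : 0 < m) :
    Integrable fun u : Fin n → ℝ =>
      (max 1 ‖u‖) ^ (-((m + n) / 2)) * ‖u‖ ^ (-((n : ℝ) / 2)) := by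
  have : Nonempty (Fin n) := ⟨⟨0, hn⟩⟩
  have hn1 : (1 : ℝ) ≤ n := by exact_mod_cast hn
  refine (integrable_fun_norm_addHaar (E := Fin n → ℝ) volume
    (f := fun t : ℝ => (max 1 t) ^ (-((m + n) / 2)) * t ^ (-((n : ℝ) / 2)))).2 ?_
  rw [Module.finrank_fin_fun, ← Ioc_union_Ioi_eq_Ioi zero_le_one, integrableOn_union]
  constructor
  · have h : IntegrableOn (fun t : ℝ => t ^ ((n : ℝ) / 2 - 1)) (Ioc 0 1) := by
      rw [← intervalIntegrable_iff_integrableOn_Ioc_of_le zero_le_one]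
      exact intervalIntegral.intervalIntegrable_rpow' (by linarith)
    refine h.congr_fun (fun t ht => ?_) measurableSet_Ioc
    simp only [max_eq_left ht.2, Real.one_rpow, one_mul, smul_eq_mul]
    rw [← Real.rpow_natCast, ← Real.rpow_add ht.1, Nat.cast_sub hn]
    congr 1
    push_cast
    ring
  · have h : IntegrableOn (fun t : ℝ => t ^ (-1 - m / 2)) (Ioi 1) :=
      integrableOn_Ioi_rpow_of_lt (by linarith) one_pos
    refine h.congr_fun (fun t (ht : 1 < t) => ?_) measurableSet_Ioi
    have ht0 : 0 < t := zero_lt_one.trans ht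
    simp only [max_eq_right ht.le, smul_eq_mul]
    rw [← Real.rpow_natCast, ← Real.rpow_add ht0, ← Real.rpow_add ht0, Nat.cast_sub hn]
    congr 1
    push_cast
    ring

theorem exists_lintegral_max_rpow_le {n : ℕ} (hn : 0 < n) {m : ℝ} (hm : 0 < m) :
    ∃ C : ℝ, 0 ≤ C ∧ ∀ ρ : ℝ, 0 < ρ →
      ∫⁻ y : Fin n → ℝ, ENNReal.ofReal (max ρ ‖y‖ ^ (-((m + n) / 2)) * ‖y‖ ^ (-((n : ℝ) / 2))) ≤
      ENNReal.ofReal (C * ρ ^ (-(m / 2))) := by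
  have hint := integrable_max_rpow_mul_rpow hn hm
  refine ⟨∫ u : Fin n → ℝ, max 1 ‖u‖ ^ (-((m + n) / 2)) * ‖u‖ ^ (-((n : ℝ) / 2)),
    integral_nonneg fun u => by positivity, fun ρ hρ => ?_⟩
  have hmax : ∀ u : Fin n → ℝ, max ρ (ρ * ‖u‖) = ρ * max 1 ‖u‖ := fun u => by
    rw [mul_max_of_nonneg _ _ hρ.le, mul_one]
  have hpow : ρ ^ (-(m / 2)) = ρ ^ n * (ρ ^ (-((m + n) / 2)) * ρ ^ (-((n : ℝ) / 2))) := by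
    rw [← Real.rpow_natCast, ← Real.rpow_add hρ, ← Real.rpow_add hρ]
    congr 1
    ring
  rw [ENNReal.ofReal_mul (integral_nonneg fun u => by positivity),
    ofReal_integral_eq_lintegral_ofReal hint (Eventually.of_forall fun u => by positivity),
    lintegral_eq_mul_lintegral_smul hρ (by fun_prop),
    ← lintegral_const_mul' _ _ ENNReal.ofReal_ne_top,
    ← lintegral_mul_const' _ _ ENNReal.ofReal_ne_top]
  refine le_of_eq (lintegral_congr fun u => ?_)
  rw [norm_smul, Real.norm_of_nonneg hρ.le, hmax, Real.mul_rpow hρ.le (by positivity),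
    Real.mul_rpow hρ.le (norm_nonneg _), ← ENNReal.ofReal_mul (by positivity),
    ← ENNReal.ofReal_mul (by positivity), hpow]
  congr 1
  ring

/-- Schur's test for the kernel `max(‖x‖, ‖y‖)^{-(m+n)/2}`, homogeneous of the critical degree,
with weights `‖x‖^{-m/2}` and `‖y‖^{-n/2}`. -/
theorem exists_kernelNormLE_of_norm_le {m n : ℕ} (hm : 0 < m) (hn : 0 < n) :
    ∃ C : ℝ, 0 < C ∧ ∀ (K : (Fin m → ℝ) → (Fin n → ℝ) → ℂ) (A : ℝ), 0 ≤ A →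
      Measurable (Function.uncurry K) →
      (∀ x y, x ≠ 0 → ‖K x y‖ ≤ A * max ‖x‖ ‖y‖ ^ (-(((m : ℝ) + n) / 2))) →
      KernelNormLE K (C * A) := by
  have : Nonempty (Fin n) := ⟨⟨0, hn⟩⟩
  have : Nonempty (Fin m) := ⟨⟨0, hm⟩⟩
  obtain ⟨C₁, hC₁, h₁⟩ := exists_lintegral_max_rpow_le hn (m := m) (by exact_mod_cast hm)
  obtain ⟨C₂, -, h₂⟩ := exists_lintegral_max_rpow_le hm (m := n) (by exact_mod_cast hn)
  refine ⟨max C₁ C₂ + 1, by positivity, fun K A hA hK hKA => ?_⟩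
  have hC₁_le : C₁ ≤ max C₁ C₂ + 1 := (le_max_left _ _).trans (le_add_of_nonneg_right zero_le_one)
  have hC₂_le : C₂ ≤ max C₁ C₂ + 1 := (le_max_right _ _).trans (le_add_of_nonneg_right zero_le_one)
  have hx0 : ∀ᵐ x : Fin m → ℝ, x ≠ 0 := Measure.ae_ne volume 0
  have hy0 : ∀ᵐ y : Fin n → ℝ, y ≠ 0 := Measure.ae_ne volume 0
  have kernel_mul_le : ∀ x y (t : ℝ), x ≠ 0 → 0 ≤ t → ‖K x y‖ₑ * ENNReal.ofReal t ≤
      ENNReal.ofReal A * ENNReal.ofReal (max ‖x‖ ‖y‖ ^ (-(((m : ℝ) + n) / 2)) * t) :=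
    fun x y t hx ht => by
      rw [← ofReal_norm, ← ENNReal.ofReal_mul (norm_nonneg _), ← ENNReal.ofReal_mul hA, ← mul_assoc]
      gcongr
      exact hKA x y hx
  refine .of_schur hK (v := fun x => ENNReal.ofReal (‖x‖ ^ (-((m : ℝ) / 2)))) (by fun_prop)
    (w := fun y => ENNReal.ofReal (‖y‖ ^ (-((n : ℝ) / 2)))) (by fun_prop) ?_ ?_ ?_
  · filter_upwards [hy0] with y hy
    have : 0 < ‖y‖ := norm_pos_iff.2 hy
    exact ⟨by simpa using Real.rpow_pos_of_pos this _, ENNReal.ofReal_ne_top⟩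
  · filter_upwards [hx0] with x hx
    grw [lintegral_mono fun y => kernel_mul_le x y _ hx (by positivity),
      lintegral_const_mul' _ _ ENNReal.ofReal_ne_top, h₁ ‖x‖ (norm_pos_iff.2 hx),
      ← ENNReal.ofReal_mul hA, ← ENNReal.ofReal_mul (by positivity)]
    rw [← mul_assoc, mul_comm A]
    gcongr
  · filter_upwards [hy0] with y hy
    grw [lintegral_mono_ae (hx0.mono fun x hx => kernel_mul_le x y _ hx (by positivity)),
      lintegral_const_mul' _ _ ENNReal.ofReal_ne_top]
    simp only [max_comm _ ‖y‖, add_comm (m : ℝ)]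
    grw [h₂ ‖y‖ (norm_pos_iff.2 hy),
      ← ENNReal.ofReal_mul hA, ← ENNReal.ofReal_mul (by positivity)]
    rw [← mul_assoc, mul_comm A]
    gcongr

end Homogeneous

section C2Bound

variable {E : Type*} [NormedAddCommGroup E] [NormedSpace ℝ E]

/-- `f` is twice continuously differentiable on `s`, with `f`, `f'`, `f''` of norm at most `B`
there. The derivatives are two-sided, also at boundary points of `s`. -/
def HasC2Bound (f : ℝ → E) (s : Set ℝ) (B : ℝ) : Prop :=
  ∃ f₁ f₂ : ℝ → E, (∀ t ∈ s, HasDerivAt f (f₁ t) t ∧ HasDerivAt f₁ (f₂ t) t) ∧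
    ContinuousOn f₂ s ∧ ∀ t ∈ s, ‖f t‖ ≤ B ∧ ‖f₁ t‖ ≤ B ∧ ‖f₂ t‖ ≤ B

namespace HasC2Bound

variable {s : Set ℝ} {A B c : ℝ}

theorem mono {f : ℝ → E} (hf : HasC2Bound f s A) (hAB : A ≤ B) : HasC2Bound f s B := by
  obtain ⟨f₁, f₂, hd, hc, hA⟩ := hf
  exact ⟨f₁, f₂, hd, hc, fun t ht =>
    ⟨(hA t ht).1.trans hAB, (hA t ht).2.1.trans hAB, (hA t ht).2.2.trans hAB⟩⟩

theorem norm_le {f : ℝ → E} (hf : HasC2Bound f s B) {t : ℝ} (ht : t ∈ s) : ‖f t‖ ≤ B := by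
  obtain ⟨f₁, f₂, -, -, hB⟩ := hf
  exact (hB t ht).1

theorem congr {f g : ℝ → E} (hf : HasC2Bound f s B) (hfg : ∀ t ∈ s, g =ᶠ[𝓝 t] f) :
    HasC2Bound g s B := by
  obtain ⟨f₁, f₂, hd, hc, hB⟩ := hf
  exact ⟨f₁, f₂, fun t ht => ⟨(hd t ht).1.congr_of_eventuallyEq (hfg t ht), (hd t ht).2⟩, hc,
    fun t ht => (hfg t ht).eq_of_nhds ▸ hB t ht⟩

protected theorem star {f : ℝ → ℂ} (hf : HasC2Bound f s B) :
    HasC2Bound (fun t => conj (f t)) s B := by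
  obtain ⟨f₁, f₂, hd, hc, hB⟩ := hf
  exact ⟨fun t => conj (f₁ t), fun t => conj (f₂ t),
    fun t ht => ⟨(hd t ht).1.star_conj, (hd t ht).2.star_conj⟩,
    Complex.continuous_conj.comp_continuousOn hc, by simpa only [RCLike.norm_conj] using hB⟩

theorem ofReal {f : ℝ → ℝ} (hf : HasC2Bound f s B) : HasC2Bound (fun t => (f t : ℂ)) s B := by
  obtain ⟨f₁, f₂, hd, hc, hB⟩ := hf
  exact ⟨fun t => f₁ t, fun t => f₂ t,
    fun t ht => ⟨(hd t ht).1.ofReal_comp, (hd t ht).2.ofReal_comp⟩,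
    Complex.continuous_ofReal.comp_continuousOn hc, by simpa only [Complex.norm_real] using hB⟩

theorem mul {f g : ℝ → ℂ} (hf : HasC2Bound f s A) (hg : HasC2Bound g s B) :
    HasC2Bound (fun t => f t * g t) s (4 * A * B) := by
  obtain ⟨f₁, f₂, hfd, hfc, hA⟩ := hf
  obtain ⟨g₁, g₂, hgd, hgc, hB⟩ := hg
  refine ⟨fun t => f₁ t * g t + f t * g₁ t,
    fun t => f₂ t * g t + f₁ t * g₁ t + (f₁ t * g₁ t + f t * g₂ t), fun t ht =>
    ⟨(hfd t ht).1.mul (hgd t ht).1,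
      ((hfd t ht).2.mul (hgd t ht).1).add ((hfd t ht).1.mul (hgd t ht).2)⟩, ?_, fun t ht => ?_⟩
  · have hf' := HasDerivAt.continuousOn fun t ht => (hfd t ht).1
    have hf₁ := HasDerivAt.continuousOn fun t ht => (hfd t ht).2
    have hg' := HasDerivAt.continuousOn fun t ht => (hgd t ht).1
    have hg₁ := HasDerivAt.continuousOn fun t ht => (hgd t ht).2
    fun_prop
  · obtain ⟨hf0, hf1, hf2⟩ := hA t ht
    obtain ⟨hg0, hg1, hg2⟩ := hB t ht
    have mul_le : ∀ {u v : ℂ}, ‖u‖ ≤ A → ‖v‖ ≤ B → ‖u * v‖ ≤ A * B := fun hu hv =>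
      norm_mul_le_of_le hu hv
    have hAB := (norm_nonneg _).trans (mul_le hf0 hg0)
    refine ⟨(mul_le hf0 hg0).trans (by linarith),
      (norm_add_le_of_le (mul_le hf1 hg0) (mul_le hf0 hg1)).trans (by linarith),
      (norm_add_le_of_le (norm_add_le_of_le (mul_le hf2 hg0) (mul_le hf1 hg1))
        (norm_add_le_of_le (mul_le hf1 hg1) (mul_le hf0 hg2))).trans (by linarith)⟩

theorem inv {f : ℝ → ℝ} (hf : HasC2Bound f s B) (hc : 0 < c) (hfc : ∀ t ∈ s, c ≤ |f t|) :
    HasC2Bound (fun t => (f t)⁻¹) s (1 / c + B / c ^ 2 + 2 * B ^ 2 / c ^ 3) := by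
  obtain ⟨f₁, f₂, hd, hf₂, hB⟩ := hf
  have h0 : ∀ t ∈ s, f t ≠ 0 := fun t ht => abs_pos.1 (hc.trans_le (hfc t ht))
  refine ⟨fun t => -f₁ t / f t ^ 2, fun t => -f₂ t / f t ^ 2 + 2 * f₁ t ^ 2 / f t ^ 3,
    fun t ht => ⟨(hd t ht).1.inv (h0 t ht), ?_⟩, ?_, fun t ht => ?_⟩
  · have := h0 t ht
    refine ((hd t ht).2.neg.div ((hd t ht).1.pow 2) (pow_ne_zero 2 this)).congr_deriv ?_
    simp only [Pi.pow_apply, Pi.neg_apply]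
    field_simp
    ring
  · have hf' := HasDerivAt.continuousOn fun t ht => (hd t ht).1
    have hf₁ := HasDerivAt.continuousOn fun t ht => (hd t ht).2
    fun_prop (disch := simpa using h0)
  · obtain ⟨-, hb1, hb2⟩ := hB t ht
    have hB0 : 0 ≤ B := (norm_nonneg _).trans hb1
    simp only [Real.norm_eq_abs] at hb1 hb2 ⊢
    have inv_le : |(f t)⁻¹| ≤ 1 / c := by
      rw [abs_inv, ← one_div]
      exact one_div_le_one_div_of_le hc (hfc t ht)
    have div_le : ∀ {u b : ℝ} (k : ℕ), |u| ≤ b → |u / f t ^ k| ≤ b / c ^ k := fun {u b} k hu => by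
      rw [abs_div, abs_pow]
      exact div_le_div₀ ((abs_nonneg u).trans hu) hu (by positivity)
        (pow_le_pow_left₀ hc.le (hfc t ht) k)
    have hsq : |2 * f₁ t ^ 2| ≤ 2 * B ^ 2 := by
      rw [abs_mul, abs_two, abs_pow]
      gcongr
    have hterms : 0 ≤ 1 / c ∧ 0 ≤ B / c ^ 2 ∧ 0 ≤ 2 * B ^ 2 / c ^ 3 := by
      refine ⟨?_, ?_, ?_⟩ <;> positivity
    refine ⟨by linarith, ?_, ?_⟩
    · linarith [div_le 2 ((abs_neg (f₁ t)).trans_le hb1)]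
    · linarith [abs_add_le (-f₂ t / f t ^ 2) (2 * f₁ t ^ 2 / f t ^ 3), div_le 3 hsq,
        div_le 2 ((abs_neg (f₂ t)).trans_le hb2)]

theorem log {f : ℝ → ℝ} (hf : HasC2Bound f s B) (hc : 0 < c) (hfc : ∀ t ∈ s, c ≤ |f t|) :
    HasC2Bound (fun t => Real.log (f t)) s (B + 1 / c + B / c + (B / c) ^ 2) := by
  obtain ⟨f₁, f₂, hd, hf₂, hB⟩ := hf
  have h0 : ∀ t ∈ s, f t ≠ 0 := fun t ht => abs_pos.1 (hc.trans_le (hfc t ht))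
  refine ⟨fun t => f₁ t / f t, fun t => f₂ t / f t - (f₁ t / f t) ^ 2,
    fun t ht => ⟨(hd t ht).1.log (h0 t ht), ?_⟩, ?_, fun t ht => ?_⟩
  · have := h0 t ht
    refine ((hd t ht).2.div (hd t ht).1 this).congr_deriv ?_
    field_simp
  · have hf' := HasDerivAt.continuousOn fun t ht => (hd t ht).1
    have hf₁ := HasDerivAt.continuousOn fun t ht => (hd t ht).2
    fun_prop (disch := exact h0)
  · obtain ⟨hb0, hb1, hb2⟩ := hB t ht
    have hB0 : 0 ≤ B := (norm_nonneg _).trans hb1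
    simp only [Real.norm_eq_abs] at hb0 hb1 hb2 ⊢
    have hpos : 0 < |f t| := hc.trans_le (hfc t ht)
    have log_le : |Real.log (f t)| ≤ B + 1 / c := by
      have hinv : |f t|⁻¹ ≤ 1 / c := by rw [inv_eq_one_div]; gcongr; exact hfc t ht
      have := one_div_pos.2 hc
      rw [← Real.log_abs, abs_le]
      constructor
      · linarith [Real.one_sub_inv_le_log_of_pos hpos]
      · linarith [Real.log_le_sub_one_of_pos hpos]
    have div_le : ∀ {u : ℝ}, |u| ≤ B → |u / f t| ≤ B / c := fun hu => by
      rw [abs_div]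
      exact div_le_div₀ hB0 hu hc (hfc t ht)
    have hsq : |(f₁ t / f t) ^ 2| ≤ (B / c) ^ 2 := by
      rw [abs_pow]
      exact pow_le_pow_left₀ (abs_nonneg _) (div_le hb1) 2
    have hterms : 0 ≤ 1 / c ∧ 0 ≤ B / c ∧ 0 ≤ (B / c) ^ 2 := by
      refine ⟨?_, ?_, ?_⟩ <;> positivity
    refine ⟨by linarith, by linarith [div_le hb1], ?_⟩
    linarith [abs_sub (f₂ t / f t) ((f₁ t / f t) ^ 2), div_le hb2]

theorem cexp_mul {L : ℝ → ℝ} (hL : HasC2Bound L s B) (hB : 0 ≤ B) (z : ℂ) :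
    HasC2Bound (fun t => Complex.exp (z * L t)) s
      (Real.exp (|z.re| * B) * (1 + B) ^ 2 * (1 + ‖z‖) ^ 2) := by
  obtain ⟨L₁, L₂, hd, hL₂, hLB⟩ := hL.ofReal
  have hexp : ∀ t ∈ s, HasDerivAt (fun t => Complex.exp (z * L t))
      (Complex.exp (z * L t) * (z * L₁ t)) t := fun t ht => ((hd t ht).1.const_mul z).cexp
  refine ⟨_, fun t => Complex.exp (z * L t) * (z * L₁ t) * (z * L₁ t) +
    Complex.exp (z * L t) * (z * L₂ t), fun t ht =>
    ⟨hexp t ht, (hexp t ht).mul ((hd t ht).2.const_mul z)⟩, ?_, fun t ht => ?_⟩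
  · have hL' := HasDerivAt.continuousOn fun t ht => (hd t ht).1
    have hL₁ := HasDerivAt.continuousOn fun t ht => (hd t ht).2
    fun_prop
  · obtain ⟨hb0, hb1, hb2⟩ := hLB t ht
    have norm_exp_le : ‖Complex.exp (z * L t)‖ ≤ Real.exp (|z.re| * B) := by
      rw [Complex.norm_real, Real.norm_eq_abs] at hb0
      rw [Complex.norm_exp, Complex.re_mul_ofReal]
      refine Real.exp_le_exp.2 ((le_abs_self _).trans ?_)
      rw [abs_mul]
      gcongr
    have h1 : ‖z * L₁ t‖ ≤ ‖z‖ * B := norm_mul_le_of_le le_rfl hb1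
    have h2 : ‖z * L₂ t‖ ≤ ‖z‖ * B := norm_mul_le_of_le le_rfl hb2
    have hz := norm_nonneg z
    have hzB : 0 ≤ ‖z‖ * B := by positivity
    have hbound : (1 + ‖z‖ * B) ^ 2 ≤ (1 + B) ^ 2 * (1 + ‖z‖) ^ 2 := by
      rw [← mul_pow]
      gcongr
      linarith
    simp only [mul_assoc (Real.exp _)]
    grw [← hbound]
    refine ⟨norm_exp_le.trans (le_mul_of_one_le_right (by positivity) (by nlinarith)),
      (norm_mul_le_of_le norm_exp_le h1).trans (by gcongr; nlinarith), ?_⟩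
    rw [mul_assoc, ← mul_add]
    refine (norm_mul_le_of_le norm_exp_le
      (norm_add_le_of_le (norm_mul_le_of_le h1 h1) h2)).trans ?_
    gcongr
    nlinarith

theorem abs_cpow {f : ℝ → ℝ} (hf : HasC2Bound f s B) (hB : 0 ≤ B) (hc : 0 < c)
    (hfc : ∀ t ∈ s, c ≤ |f t|) {σ : ℝ} {z : ℂ} (hz : |z.re| ≤ σ) :
    HasC2Bound (fun t => ((|f t| : ℝ) : ℂ) ^ z) s
      (Real.exp (σ * (B + 1 / c + B / c + (B / c) ^ 2)) *
        (1 + (B + 1 / c + B / c + (B / c) ^ 2)) ^ 2 * (1 + ‖z‖) ^ 2) := by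
  have hlog := hf.log hc hfc
  have hB' : 0 ≤ B + 1 / c + B / c + (B / c) ^ 2 := by positivity
  obtain ⟨f₁, f₂, hd, -⟩ := hf
  refine ((hlog.cexp_mul hB' z).congr fun t ht => ?_).mono (by gcongr)
  filter_upwards [(hd t ht).1.continuousAt.eventually_ne
    (abs_pos.1 (hc.trans_le (hfc t ht)))] with u hu
  rw [Complex.cpow_def_of_ne_zero (by exact_mod_cast (abs_pos.2 hu).ne'),
    ← Complex.ofReal_log (abs_nonneg _), Real.log_abs, mul_comm]

end HasC2Bound

end C2Bound

section OscillatoryIntegral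

theorem norm_cexp_I_mul_ofReal (a : ℝ) : ‖Complex.exp (Complex.I * a)‖ = 1 := by
  rw [mul_comm]
  exact Complex.norm_exp_ofReal_mul_I a

/-- Integration by parts, writing `e^{iμΦ} = (iμ)⁻¹ g (e^{iμΦ})'` with `g = 1/Φ'`. -/
theorem integral_cexp_mul_eq {α β μ : ℝ} (hαβ : α ≤ β) (hμ : μ ≠ 0) {Φ p : ℝ → ℝ}
    {g g' q q' : ℝ → ℂ} (hΦ : ∀ s ∈ Icc α β, HasDerivAt Φ (p s) s)
    (hpg : ∀ s ∈ Icc α β, (p s : ℂ) * g s = 1)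
    (hg : ∀ s ∈ Icc α β, HasDerivAt g (g' s) s) (hg' : ContinuousOn g' (Icc α β))
    (hq : ∀ s ∈ Icc α β, HasDerivAt q (q' s) s) (hq' : ContinuousOn q' (Icc α β))
    (hqα : q α = 0) (hqβ : q β = 0) :
    ∫ s in α..β, Complex.exp (Complex.I * (μ * Φ s : ℝ)) * q s =
      Complex.I / μ * ∫ s in α..β, Complex.exp (Complex.I * (μ * Φ s : ℝ)) *
        (q' s * g s + q s * g' s) := by
  have hI : uIcc α β = Icc α β := uIcc_of_le hαβ
  set e : ℝ → ℂ := fun s => Complex.exp (Complex.I * (μ * Φ s : ℝ))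
  have he : ∀ s ∈ Icc α β, HasDerivAt e (e s * (Complex.I * (μ * p s : ℝ))) s := fun s hs =>
    ((((hΦ s hs).const_mul μ).ofReal_comp).const_mul Complex.I).cexp
  have hec := HasDerivAt.continuousOn he
  have hgc := HasDerivAt.continuousOn hg
  have hqc := HasDerivAt.continuousOn hq
  have hint_q : IntervalIntegrable (fun s => e s * q s) volume α β :=
    (hI ▸ hec.mul hqc).intervalIntegrable
  have hint_deriv : IntervalIntegrable (fun s => e s * (q' s * g s + q s * g' s)) volume α β :=
    (hI ▸ hec.mul ((hq'.mul hgc).add (hqc.mul hg'))).intervalIntegrable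
  have boundary := intervalIntegral.integral_eq_sub_of_hasDerivAt
    (f := fun s => e s * (q s * g s))
    (f' := fun s => Complex.I * μ * (e s * q s) + e s * (q' s * g s + q s * g' s))
    (fun s hs => ?_) ((hint_q.const_mul _).add hint_deriv)
  · rw [intervalIntegral.integral_add (hint_q.const_mul _) hint_deriv,
      intervalIntegral.integral_const_mul, hqα, hqβ] at boundary
    have hμ' : (μ : ℂ) ≠ 0 := by exact_mod_cast hμ
    field_simp
    linear_combination (-Complex.I) * boundary + μ * (∫ s in α..β, e s * q s) * Complex.I_sq
  · rw [hI] at hs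
    refine ((he s hs).mul ((hq s hs).mul (hg s hs))).congr_deriv ?_
    rw [Pi.mul_apply]
    push_cast
    linear_combination Complex.I * μ * e s * q s * hpg s hs

theorem norm_integral_cexp_mul_le {α β μ B : ℝ} (hαβ : α ≤ β) {Φ : ℝ → ℝ} {b : ℝ → ℂ}
    (hb : ∀ s ∈ Icc α β, ‖b s‖ ≤ B) :
    ‖∫ s in α..β, Complex.exp (Complex.I * (μ * Φ s : ℝ)) * b s‖ ≤ (β - α) * B := by
  have := intervalIntegral.norm_integral_le_of_norm_le_const (a := α) (b := β) (C := B)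
    (f := fun s => Complex.exp (Complex.I * (μ * Φ s : ℝ)) * b s) fun s hs => by
      rw [norm_mul, norm_cexp_I_mul_ofReal, one_mul]
      rw [uIoc_of_le hαβ] at hs
      exact hb s (Ioc_subset_Icc_self hs)
  rwa [abs_of_nonneg (sub_nonneg.2 hαβ), mul_comm] at this

theorem hasDerivAt_eq_zero_of_eqOn_Iic {b : ℝ → ℂ} {b' : ℂ} {α : ℝ} (hb : HasDerivAt b b' α)
    (h0 : EqOn b 0 (Iic α)) : b' = 0 :=
  (uniqueDiffWithinAt_Iic α).eq_deriv _ hb.hasDerivWithinAt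
    ((hasDerivWithinAt_const α (Iic α) 0).congr h0 (h0 self_mem_Iic))

theorem hasDerivAt_eq_zero_of_eqOn_Ici {b : ℝ → ℂ} {b' : ℂ} {α : ℝ} (hb : HasDerivAt b b' α)
    (h0 : EqOn b 0 (Ici α)) : b' = 0 :=
  (uniqueDiffWithinAt_Ici α).eq_deriv _ hb.hasDerivWithinAt
    ((hasDerivWithinAt_const α (Ici α) 0).congr h0 (h0 self_mem_Ici))

theorem norm_integral_cexp_mul_mul_sq_le {α β μ B G : ℝ} (hαβ : α ≤ β) {Φ p : ℝ → ℝ} {b g : ℝ → ℂ}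
    (hΦ : ∀ s ∈ Icc α β, HasDerivAt Φ (p s) s) (hpg : ∀ s ∈ Icc α β, (p s : ℂ) * g s = 1)
    (hg : HasC2Bound g (Icc α β) G) (hb : HasC2Bound b (Icc α β) B)
    (hb0 : ∀ s ∉ Ioo α β, b s = 0) :
    ‖∫ s in α..β, Complex.exp (Complex.I * (μ * Φ s : ℝ)) * b s‖ * μ ^ 2 ≤
      (β - α) * (6 * G ^ 2 * B) := by
  rcases eq_or_ne μ 0 with rfl | hμ
  · have hα := left_mem_Icc.2 hαβ
    have := (norm_nonneg _).trans (hb.norm_le hα)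
    have := sub_nonneg.2 hαβ
    simp only [ne_eq, two_ne_zero, not_false_eq_true, zero_pow, mul_zero]
    positivity
  obtain ⟨g₁, g₂, hg, hg₂, hG⟩ := hg
  obtain ⟨b₁, b₂, hbd, hb₂, hB⟩ := hb
  have hg' := HasDerivAt.continuousOn fun s hs => (hg s hs).1
  have hg₁ := HasDerivAt.continuousOn fun s hs => (hg s hs).2
  have hb' := HasDerivAt.continuousOn fun s hs => (hbd s hs).1
  have hb₁ := HasDerivAt.continuousOn fun s hs => (hbd s hs).2
  have hbα : b α = 0 := hb0 α fun h => lt_irrefl _ h.1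
  have hbβ : b β = 0 := hb0 β fun h => lt_irrefl _ h.2
  have hb₁α : b₁ α = 0 := hasDerivAt_eq_zero_of_eqOn_Iic (hbd α (left_mem_Icc.2 hαβ)).1
    fun s hs => hb0 s fun h => not_lt.2 hs h.1
  have hb₁β : b₁ β = 0 := hasDerivAt_eq_zero_of_eqOn_Ici (hbd β (right_mem_Icc.2 hαβ)).1
    fun s hs => hb0 s fun h => not_lt.2 hs h.2
  rw [integral_cexp_mul_eq hαβ hμ hΦ hpg (fun s hs => (hg s hs).1) hg₁
      (fun s hs => (hbd s hs).1) hb₁ hbα hbβ,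
    integral_cexp_mul_eq hαβ hμ hΦ hpg (fun s hs => (hg s hs).1) hg₁
      (q := fun s => b₁ s * g s + b s * g₁ s)
      (q' := fun s => b₂ s * g s + b₁ s * g₁ s + (b₁ s * g₁ s + b s * g₂ s))
      (fun s hs => ((hbd s hs).2.mul (hg s hs).1).add ((hbd s hs).1.mul (hg s hs).2))
      (by fun_prop) (by simp [hbα, hb₁α]) (by simp [hbβ, hb₁β]),
    norm_mul, norm_mul, norm_div, Complex.norm_I, Complex.norm_real, Real.norm_eq_abs]
  grw [norm_integral_cexp_mul_le hαβ (B := 6 * G ^ 2 * B) fun s hs => ?_]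
  · refine le_of_eq ?_
    rw [← sq_abs μ]
    field_simp [abs_ne_zero.2 hμ]
  · obtain ⟨hb0, hb1, hb2⟩ := hB s hs
    obtain ⟨hg0, hg1, hg2⟩ := hG s hs
    have mul_le : ∀ {u v : ℂ}, ‖u‖ ≤ B → ‖v‖ ≤ G → ‖u * v‖ ≤ B * G := fun hu hv =>
      norm_mul_le_of_le hu hv
    refine (norm_add_le_of_le
      (norm_mul_le_of_le (norm_add_le_of_le (norm_add_le_of_le (mul_le hb2 hg0) (mul_le hb1 hg1))
        (norm_add_le_of_le (mul_le hb1 hg1) (mul_le hb0 hg2))) hg0)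
      (norm_mul_le_of_le (norm_add_le_of_le (mul_le hb1 hg0) (mul_le hb0 hg1)) hg1)).trans_eq ?_
    ring

theorem norm_integral_cexp_mul_le_inv {α β μ B G : ℝ} (hαβ : α ≤ β) {Φ p : ℝ → ℝ} {b g : ℝ → ℂ}
    (hΦ : ∀ s ∈ Icc α β, HasDerivAt Φ (p s) s) (hpg : ∀ s ∈ Icc α β, (p s : ℂ) * g s = 1)
    (hg : HasC2Bound g (Icc α β) G) (hb : HasC2Bound b (Icc α β) B)
    (hb0 : ∀ s ∉ Ioo α β, b s = 0) :
    ‖∫ s in α..β, Complex.exp (Complex.I * (μ * Φ s : ℝ)) * b s‖ ≤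
      (β - α) * (1 + 6 * G ^ 2) * B * (1 + μ ^ 2)⁻¹ := by
  have trivial_bound := norm_integral_cexp_mul_le (μ := μ) (Φ := Φ) hαβ (B := B) (b := b)
    fun s hs => hb.norm_le hs
  have decay := norm_integral_cexp_mul_mul_sq_le (μ := μ) hαβ hΦ hpg hg hb hb0
  rw [← div_eq_mul_inv, le_div_iff₀ (by positivity)]
  linarith

end OscillatoryIntegral

section ConjKernel

theorem lintegral_mul_lintegral_mul_le {Y : Type*} [MeasurableSpace Y] (ν : Measure Y) [SFinite ν]
    {H : Y → Y → ℝ≥0∞} (hH : Measurable (Function.uncurry H)) {B : ℝ≥0∞}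
    (hrow : ∀ y, ∫⁻ y', H y y' ∂ν ≤ B) (hcol : ∀ y', ∫⁻ y, H y y' ∂ν ≤ B)
    {g : Y → ℝ≥0∞} (hg : Measurable g) :
    ∫⁻ y, g y * ∫⁻ y', H y y' * g y' ∂ν ∂ν ≤ B * ∫⁻ y, g y ^ 2 ∂ν := by
  have hHg : Measurable fun y => ∫⁻ y', H y y' * g y' ∂ν :=
    (hH.mul (hg.comp measurable_snd)).lintegral_prod_right
  have schur := lintegral_schur_test ν ν hH (v := 1) measurable_one (w := 1) measurable_one
    (by simp) (Eventually.of_forall fun y => by simpa using hrow y)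
    (Eventually.of_forall fun y => by simpa using hcol y) hg
  refine (ENNReal.pow_right_strictMono two_ne_zero).le_iff_le.1 ?_
  calc (∫⁻ y, g y * ∫⁻ y', H y y' * g y' ∂ν ∂ν) ^ 2
      ≤ (∫⁻ y, g y ^ 2 ∂ν) * ∫⁻ y, (∫⁻ y', H y y' * g y' ∂ν) ^ 2 ∂ν :=
        lintegral_mul_sq_le ν hg.aemeasurable hHg.aemeasurable
    _ ≤ (∫⁻ y, g y ^ 2 ∂ν) * (B * B * ∫⁻ y, g y ^ 2 ∂ν) := by gcongr
    _ = (B * ∫⁻ y, g y ^ 2 ∂ν) ^ 2 := by ring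

theorem lintegral_enorm_sq_eq_enorm_integral {X : Type*} [MeasurableSpace X] {μ : Measure X}
    {F : X → ℂ} (hF : Integrable (fun x => F x * conj (F x)) μ) :
    ∫⁻ x, ‖F x‖ₑ ^ 2 ∂μ = ‖∫ x, F x * conj (F x) ∂μ‖ₑ := by
  have hnorm : ∀ x, F x * conj (F x) = (‖F x * conj (F x)‖ : ℝ) := fun x => by
    rw [Complex.mul_conj, Complex.norm_real, Real.norm_of_nonneg (Complex.normSq_nonneg _)]
  calc ∫⁻ x, ‖F x‖ₑ ^ 2 ∂μ = ∫⁻ x, ‖F x * conj (F x)‖ₑ ∂μ := by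
        simp only [enorm_mul, RCLike.enorm_conj, sq]
    _ = ENNReal.ofReal (∫ x, ‖F x * conj (F x)‖ ∂μ) :=
        (ofReal_integral_norm_eq_lintegral_enorm hF).symm
    _ = ‖∫ x, F x * conj (F x) ∂μ‖ₑ := by
        rw [integral_congr_ae (Eventually.of_forall hnorm), integral_complex_ofReal,
          ← ofReal_norm, Complex.norm_real,
          Real.norm_of_nonneg (integral_nonneg fun x => norm_nonneg _)]

variable {X Y : Type*} [MeasureSpace X] [MeasureSpace Y]

/-- A bounded measurable kernel supported in a product `I × J` of measurable sets of finite
measure; Fubini's theorem applies to such a kernel integrated against `L²` functions. -/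
structure IsBoundedKernelOn (K : X → Y → ℂ) (I : Set X) (J : Set Y) : Prop where
  measurable : Measurable (Function.uncurry K)
  bounded : ∃ M, ∀ x y, ‖K x y‖ ≤ M
  measurableSet_left : MeasurableSet I
  measurableSet_right : MeasurableSet J
  volume_left_ne_top : volume I ≠ ⊤
  volume_right_ne_top : volume J ≠ ⊤
  eq_zero_left : ∀ x ∉ I, ∀ y, K x y = 0
  eq_zero_right : ∀ x, ∀ y ∉ J, K x y = 0

namespace IsBoundedKernelOn

variable {K : X → Y → ℂ} {I : Set X} {J : Set Y} {f : Y → ℂ}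

theorem mul_indicator (hK : IsBoundedKernelOn K I J) (x : X) :
    (fun y => K x y * J.indicator f y) = fun y => K x y * f y := funext fun y => by
  by_cases hy : y ∈ J
  · rw [indicator_of_mem hy]
  · rw [hK.eq_zero_right x y hy, zero_mul, zero_mul]

theorem integrable_indicator (hK : IsBoundedKernelOn K I J) (hf : MemLp f 2 volume) :
    Integrable (J.indicator f) := by
  have : Fact (volume J < ⊤) := ⟨hK.volume_right_ne_top.lt_top⟩
  exact (integrable_indicator_iff hK.measurableSet_right).2
    ((hf.restrict J).integrable one_le_two)

theorem integrable_mul (hK : IsBoundedKernelOn K I J) (hf : MemLp f 2 volume) (x : X) :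
    Integrable fun y => K x y * f y := by
  obtain ⟨M, hM⟩ := hK.bounded
  rw [← hK.mul_indicator]
  exact (hK.integrable_indicator hf).bdd_mul
    (hK.measurable.comp measurable_prodMk_left).aestronglyMeasurable (Eventually.of_forall (hM x))

theorem integrable_mul_conj (hK : IsBoundedKernelOn K I J) {g : Y → ℂ} (hg : Integrable g) :
    Integrable (Function.uncurry fun (x : X) (p : Y × Y) =>
      K x p.1 * conj (K x p.2) * (g p.1 * conj (g p.2))) := by
  obtain ⟨M, hM⟩ := hK.bounded
  have hdom : Integrable fun q : X × Y × Y =>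
      I.indicator (fun _ => (1 : ℂ)) q.1 * (g q.2.1 * conj (g q.2.2)) :=
    ((integrable_indicator_iff hK.measurableSet_left).2
      (integrableOn_const hK.volume_left_ne_top)).mul_prod
      (hg.mul_prod (Complex.conjCLE.integrable_comp_iff.2 hg))
  have hmeas : ∀ {e : X × Y × Y → Y}, Measurable e → Measurable fun q => K q.1 (e q) :=
    fun he => hK.measurable.comp (measurable_fst.prodMk he)
  have hbdd := hdom.bdd_mul (c := M * M)
    (f := fun q : X × Y × Y => K q.1 q.2.1 * conj (K q.1 q.2.2))
    ((hmeas (by fun_prop)).mul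
      (Complex.continuous_conj.measurable.comp (hmeas (by fun_prop)))).aestronglyMeasurable
    (Eventually.of_forall fun q =>
      norm_mul_le_of_le (hM _ _) ((RCLike.norm_conj _).trans_le (hM _ _)))
  refine hbdd.congr (Eventually.of_forall fun ⟨x, y, y'⟩ => ?_)
  by_cases hx : x ∈ I
  · simp only [Function.uncurry, indicator_of_mem hx, one_mul]
  · simp only [Function.uncurry, hK.eq_zero_left x hx, zero_mul]

variable [SFinite (volume : Measure X)] [SFinite (volume : Measure Y)]

theorem lintegral_enorm_integral_sq (hK : IsBoundedKernelOn K I J) {g : Y → ℂ}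
    (hg : Integrable g) :
    ∫⁻ x, ‖∫ y, K x y * g y‖ₑ ^ 2 =
      ‖∫ p : Y × Y, (∫ x, K x p.1 * conj (K x p.2)) * (g p.1 * conj (g p.2))‖ₑ := by
  have hprod := hK.integrable_mul_conj hg
  have hexpand : (fun x => (∫ y, K x y * g y) * conj (∫ y, K x y * g y)) =
      fun x => ∫ p : Y × Y, K x p.1 * conj (K x p.2) * (g p.1 * conj (g p.2)) := by
    ext x
    rw [← integral_conj, ← integral_prod_mul]
    simp only [map_mul, mul_mul_mul_comm, Measure.volume_eq_prod]
  rw [lintegral_enorm_sq_eq_enorm_integral (hexpand ▸ hprod.integral_prod_left), hexpand,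
    integral_integral_swap hprod]
  simp only [integral_mul_const]

/-- The `TT*` method: an `L²` bound for `K` follows from Schur's test applied to the kernel
`∫ K(x, y) conj K(x, y') dx` of the composition with the adjoint. -/
theorem kernelNormLE_sqrt (hK : IsBoundedKernelOn K I J) {H : Y → Y → ℝ≥0∞}
    (hH : Measurable (Function.uncurry H)) {B : ℝ} (hB : 0 ≤ B)
    (hKH : ∀ y y', ‖∫ x, K x y * conj (K x y')‖ₑ ≤ H y y')
    (hrow : ∀ y, ∫⁻ y', H y y' ≤ ENNReal.ofReal B)
    (hcol : ∀ y', ∫⁻ y, H y y' ≤ ENNReal.ofReal B) : KernelNormLE K (√B) := by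
  refine .of_measurable hK.measurable fun f hf hf2 =>
    ⟨Eventually.of_forall fun x => hK.integrable_mul hf2 x, ?_⟩
  set g : Y → ℂ := J.indicator f
  have hg : Measurable g := hf.indicator hK.measurableSet_right
  simp only [← hK.mul_indicator (f := f)]
  rw [hK.lintegral_enorm_integral_sq (hK.integrable_indicator hf2),
    ← ENNReal.ofReal_pow (Real.sqrt_nonneg B), Real.sq_sqrt hB]
  calc ‖∫ p : Y × Y, (∫ x, K x p.1 * conj (K x p.2)) * (g p.1 * conj (g p.2))‖ₑ
      ≤ ∫⁻ p : Y × Y, ‖(∫ x, K x p.1 * conj (K x p.2)) * (g p.1 * conj (g p.2))‖ₑ :=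
        enorm_integral_le_lintegral_enorm _
    _ ≤ ∫⁻ p : Y × Y, H p.1 p.2 * (‖g p.1‖ₑ * ‖g p.2‖ₑ) := by
        refine lintegral_mono fun p => ?_
        simp only [enorm_mul, RCLike.enorm_conj]
        gcongr
        exact hKH _ _
    _ = ∫⁻ y, ∫⁻ y', H y y' * (‖g y‖ₑ * ‖g y'‖ₑ) :=
        lintegral_prod _ (hH.mul ((hg.enorm.comp measurable_fst).mul
          (hg.enorm.comp measurable_snd))).aemeasurable
    _ = ∫⁻ y, ‖g y‖ₑ * ∫⁻ y', H y y' * ‖g y'‖ₑ := by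
        simp only [← lintegral_const_mul' _ _ enorm_ne_top, mul_left_comm]
    _ ≤ ENNReal.ofReal B * ∫⁻ y, ‖g y‖ₑ ^ 2 :=
        lintegral_mul_lintegral_mul_le volume hH hrow hcol hg.enorm
    _ ≤ ENNReal.ofReal B * ∫⁻ y, ‖f y‖ₑ ^ 2 := by
        gcongr with y
        exact enorm_indicator_le_enorm_self f y

end IsBoundedKernelOn

end ConjKernel

section Slices

theorem enorm_integral_sq_le_mul {Y : Type*} [MeasurableSpace Y] {ν : Measure Y} {J : Set Y}
    (hJ : MeasurableSet J) {T : Y → ℂ} (hT : Measurable T) (hT0 : ∀ y ∉ J, T y = 0) :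
    ‖∫ y, T y ∂ν‖ₑ ^ 2 ≤ ν J * ∫⁻ y, ‖T y‖ₑ ^ 2 ∂ν := by
  have hind : ∀ y, ‖T y‖ₑ = J.indicator 1 y * ‖T y‖ₑ := fun y => by
    by_cases hy : y ∈ J <;> simp [hy, hT0]
  calc ‖∫ y, T y ∂ν‖ₑ ^ 2 ≤ (∫⁻ y, J.indicator 1 y * ‖T y‖ₑ ∂ν) ^ 2 := by
        simp only [← hind]
        gcongr
        exact enorm_integral_le_lintegral_enorm _
    _ ≤ (∫⁻ y, J.indicator 1 y ^ 2 ∂ν) * ∫⁻ y, ‖T y‖ₑ ^ 2 ∂ν :=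
        lintegral_mul_sq_le ν (measurable_one.indicator hJ).aemeasurable hT.enorm.aemeasurable
    _ = ν J * ∫⁻ y, ‖T y‖ₑ ^ 2 ∂ν := by
        congr 1
        rw [← lintegral_indicator_one hJ]
        congr with y
        by_cases hy : y ∈ J <;> simp [hy]

variable {X₁ X₂ Y₁ Y₂ : Type*} [MeasureSpace X₁] [MeasureSpace X₂] [MeasureSpace Y₁]
  [MeasureSpace Y₂] [SFinite (volume : Measure X₁)]
  [SFinite (volume : Measure Y₁)] [SFinite (volume : Measure Y₂)] {K : X₁ × X₂ → Y₁ × Y₂ → ℂ}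
  {I₁ : Set X₁} {I : Set X₂} {J₁ : Set Y₁} {J : Set Y₂} {A : ℝ}

theorem lintegral_slice_enorm_sq_le (hK : IsBoundedKernelOn K (I₁ ×ˢ I) (J₁ ×ˢ J))
    (hJ : MeasurableSet J) {x₂ : X₂}
    (h : ∀ y₂ ∈ J, KernelNormLE (fun x₁ y₁ => K (x₁, x₂) (y₁, y₂)) A)
    {f : Y₁ × Y₂ → ℂ} (hf : Measurable f) (hf2 : MemLp f 2 volume) :
    ∫⁻ x₁, ‖∫ y, K (x₁, x₂) y * f y‖ₑ ^ 2 ≤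
      volume J * (ENNReal.ofReal A ^ 2 * ∫⁻ y, ‖f y‖ₑ ^ 2) := by
  set T : X₁ → Y₂ → ℂ := fun x₁ y₂ => ∫ y₁, K (x₁, x₂) (y₁, y₂) * f (y₁, y₂) with hT
  have hTm : Measurable (Function.uncurry T) := by
    have hint : Measurable fun r : (X₁ × Y₂) × Y₁ => K (r.1.1, x₂) (r.2, r.1.2) * f (r.2, r.1.2) :=
      (hK.measurable.comp (by fun_prop : Measurable fun r : (X₁ × Y₂) × Y₁ =>
        ((r.1.1, x₂), (r.2, r.1.2)))).mul (hf.comp (by fun_prop))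
    exact hint.stronglyMeasurable.integral_prod_right.measurable
  have hT0 : ∀ x₁, ∀ y₂ ∉ J, T x₁ y₂ = 0 := fun x₁ y₂ hy => by
    simp only [hT, fun y₁ => hK.eq_zero_right (x₁, x₂) (y₁, y₂) fun hmem => hy hmem.2, zero_mul,
      integral_zero]
  have hf_slice : ∀ᵐ y₂, ∫⁻ y₁, ‖f (y₁, y₂)‖ₑ ^ 2 < ⊤ := by
    refine ae_lt_top (hf.enorm.pow_const 2).lintegral_prod_left ?_
    rw [← lintegral_prod_symm' _ (hf.enorm.pow_const 2), ← Measure.volume_eq_prod, ← eLpNorm_two_sq]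
    exact ENNReal.pow_ne_top hf2.eLpNorm_ne_top
  calc ∫⁻ x₁, ‖∫ y, K (x₁, x₂) y * f y‖ₑ ^ 2
      ≤ ∫⁻ x₁, volume J * ∫⁻ y₂, ‖T x₁ y₂‖ₑ ^ 2 := lintegral_mono fun x₁ => by
        rw [Measure.volume_eq_prod, integral_prod_symm _ (hK.integrable_mul hf2 (x₁, x₂))]
        exact enorm_integral_sq_le_mul hJ (hTm.comp measurable_prodMk_left) (hT0 x₁)
    _ = volume J * ∫⁻ y₂, ∫⁻ x₁, ‖T x₁ y₂‖ₑ ^ 2 := by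
        rw [lintegral_const_mul _ (hTm.enorm.pow_const 2).lintegral_prod_right,
          lintegral_lintegral_swap (hTm.enorm.pow_const 2).aemeasurable]
    _ ≤ volume J * ∫⁻ y₂, ENNReal.ofReal A ^ 2 * ∫⁻ y₁, ‖f (y₁, y₂)‖ₑ ^ 2 := by
        refine mul_le_mul_right (lintegral_mono_ae ?_) _
        filter_upwards [hf_slice] with y₂ hy₂
        by_cases hy : y₂ ∈ J
        · rw [← eLpNorm_two_sq, ENNReal.pow_lt_top_iff, or_iff_left two_ne_zero] at hy₂
          exact (h y₂ hy).lintegral_sq_le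
            ⟨(hf.comp measurable_prodMk_right).aestronglyMeasurable, hy₂⟩
        · simp [hT0 _ y₂ hy]
    _ = volume J * (ENNReal.ofReal A ^ 2 * ∫⁻ y, ‖f y‖ₑ ^ 2) := by
        rw [lintegral_const_mul' _ _ (ENNReal.pow_ne_top ENNReal.ofReal_ne_top),
          Measure.volume_eq_prod, lintegral_prod_symm' _ (hf.enorm.pow_const 2)]

theorem IsBoundedKernelOn.kernelNormLE_of_slices [SFinite (volume : Measure X₂)]
    (hK : IsBoundedKernelOn K (I₁ ×ˢ I) (J₁ ×ˢ J)) (hI : MeasurableSet I) (hJ : MeasurableSet J)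
    {a b : ℝ} (ha : 0 ≤ a) (hb : 0 ≤ b) (hIa : volume I ≤ ENNReal.ofReal (a ^ 2))
    (hJb : volume J ≤ ENNReal.ofReal (b ^ 2))
    (h : ∀ x₂ ∈ I, ∀ y₂ ∈ J, KernelNormLE (fun x₁ y₁ => K (x₁, x₂) (y₁, y₂)) A) :
    KernelNormLE K (a * b * A) := by
  refine .of_measurable hK.measurable fun f hf hf2 =>
    ⟨Eventually.of_forall fun x => hK.integrable_mul hf2 x, ?_⟩
  set N := ∫⁻ y, ‖f y‖ₑ ^ 2
  have hFm : Measurable fun x => ‖∫ y, K x y * f y‖ₑ ^ 2 :=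
    ((hK.measurable.mul (hf.comp measurable_snd)).stronglyMeasurable.integral_prod_right
      ).measurable.enorm.pow_const 2
  calc ∫⁻ x, ‖∫ y, K x y * f y‖ₑ ^ 2
      = ∫⁻ x₂, ∫⁻ x₁, ‖∫ y, K (x₁, x₂) y * f y‖ₑ ^ 2 := lintegral_prod_symm' _ hFm
    _ ≤ ∫⁻ x₂, I.indicator (fun _ => volume J * (ENNReal.ofReal A ^ 2 * N)) x₂ := by
        refine lintegral_mono fun x₂ => ?_
        by_cases hx : x₂ ∈ I
        · rw [indicator_of_mem hx]
          exact lintegral_slice_enorm_sq_le hK hJ (h x₂ hx) hf hf2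
        · simp [fun x₁ => hK.eq_zero_left (x₁, x₂) fun hmem => hx hmem.2]
    _ = volume J * (ENNReal.ofReal A ^ 2 * N) * volume I := lintegral_indicator_const hI _
    _ ≤ ENNReal.ofReal (b ^ 2) * (ENNReal.ofReal A ^ 2 * N) * ENNReal.ofReal (a ^ 2) := by gcongr
    _ = ENNReal.ofReal (a * b * A) ^ 2 * N := by
        rw [ENNReal.ofReal_mul (by positivity), ENNReal.ofReal_mul ha, ENNReal.ofReal_pow ha,
          ENNReal.ofReal_pow hb]
        ring

end Slices

section OneDimensional

theorem lintegral_inv_one_add_sq_mul_sub {B μ : ℝ} (hB : 0 ≤ B) (hμ : μ ≠ 0) (t : ℝ) :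
    ∫⁻ t' : ℝ, ENNReal.ofReal (B * (1 + (μ * (t - t')) ^ 2)⁻¹) =
      ENNReal.ofReal (B * (Real.pi / |μ|)) := by
  have hint : Integrable fun t' : ℝ => (1 + (μ * (t - t')) ^ 2)⁻¹ :=
    (integrable_inv_one_add_sq.comp_mul_left' hμ).comp_sub_left t
  rw [← ofReal_integral_eq_lintegral_ofReal (hint.const_mul B)
    (Eventually.of_forall fun t' => by positivity), integral_const_mul,
    integral_sub_left_eq_self (fun u => (1 + (μ * u) ^ 2)⁻¹) volume t,
    Measure.integral_comp_mul_left (fun u => (1 + u ^ 2)⁻¹) μ, integral_univ_inv_one_add_sq,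
    smul_eq_mul, abs_inv]
  congr 2
  ring

theorem integral_oscillatory_mul_conj {α β μ : ℝ} (hαβ : α ≤ β) {P : ℝ → ℝ → ℝ} {a : ℝ → ℝ → ℂ}
    {t t' : ℝ} (ha0 : ∀ s ∉ Ioo α β, a s t = 0) :
    ∫ s, Complex.exp (Complex.I * (μ * P s t : ℝ)) * a s t *
        conj (Complex.exp (Complex.I * (μ * P s t' : ℝ)) * a s t') =
      ∫ s in α..β, Complex.exp (Complex.I * (μ * (P s t - P s t') : ℝ)) *
        (a s t * conj (a s t')) := by
  rw [intervalIntegral.integral_of_le hαβ, setIntegral_eq_integral_of_forall_compl_eq_zero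
    fun s hs => by rw [ha0 s fun h => hs (Ioo_subset_Ioc_self h), zero_mul, mul_zero]]
  refine integral_congr_ae (Eventually.of_forall fun s => ?_)
  have hexp : Complex.exp (Complex.I * (μ * (P s t - P s t') : ℝ)) =
      Complex.exp (Complex.I * (μ * P s t : ℝ)) * Complex.exp (-Complex.I * (μ * P s t' : ℝ)) := by
    rw [← Complex.exp_add]
    congr 1
    push_cast
    ring
  simp only [map_mul, ← Complex.exp_conj, Complex.conj_I, Complex.conj_ofReal, hexp]
  ring

theorem norm_integral_oscillatory_mul_conj_le {α β γ κ μ G A : ℝ} (hαβ : α ≤ β)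
    {P P₁ : ℝ → ℝ → ℝ} {a : ℝ → ℝ → ℂ}
    (ha0 : ∀ s t, s ∉ Ioo α β ∨ t ∉ Icc γ κ → a s t = 0)
    (ha : ∀ t ∈ Icc γ κ, HasC2Bound (fun s => a s t) (Icc α β) A)
    (hP : ∀ t ∈ Icc γ κ, ∀ s ∈ Icc α β, HasDerivAt (fun s => P s t) (P₁ s t) s)
    (hP₁ : ∀ t ∈ Icc γ κ, ∀ t' ∈ Icc γ κ, t ≠ t' → ∀ s ∈ Icc α β, P₁ s t ≠ P₁ s t')
    (hG : ∀ t ∈ Icc γ κ, ∀ t' ∈ Icc γ κ, t ≠ t' →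
      HasC2Bound (fun s => (t - t') / (P₁ s t - P₁ s t')) (Icc α β) G) (t t' : ℝ) :
    ‖∫ s, Complex.exp (Complex.I * (μ * P s t : ℝ)) * a s t *
        conj (Complex.exp (Complex.I * (μ * P s t' : ℝ)) * a s t')‖ ≤
      (β - α) * (1 + 6 * G ^ 2) * (4 * A * A) * (1 + (μ * (t - t')) ^ 2)⁻¹ := by
  have hβα : 0 ≤ β - α := sub_nonneg.2 hαβ
  have hA2 : 0 ≤ 4 * A * A := by nlinarith [mul_self_nonneg A]
  by_cases hmem : t ∈ Icc γ κ ∧ t' ∈ Icc γ κ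
  swap
  · have hzero : ∀ s, a s t = 0 ∨ a s t' = 0 := fun s =>
      (not_and_or.1 hmem).imp (fun h => ha0 s t (.inr h)) fun h => ha0 s t' (.inr h)
    rw [integral_eq_zero_of_ae (Eventually.of_forall fun s => ?_), norm_zero]
    · positivity
    · rcases hzero s with h | h <;> simp [h]
  obtain ⟨ht, ht'⟩ := hmem
  have hb : HasC2Bound (fun s => a s t * conj (a s t')) (Icc α β) (4 * A * A) :=
    (ha t ht).mul (ha t' ht').star
  rw [integral_oscillatory_mul_conj hαβ fun s hs => ha0 s t (.inl hs)]
  rcases eq_or_ne t t' with rfl | hne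
  · have := norm_integral_cexp_mul_le (μ := μ) (Φ := fun s => P s t - P s t) hαβ
      fun s hs => hb.norm_le hs
    refine this.trans ?_
    rw [sub_self, mul_zero, zero_pow two_ne_zero, add_zero, inv_one, mul_one]
    nlinarith [mul_nonneg hβα hA2, sq_nonneg G]
  have htt : t - t' ≠ 0 := sub_ne_zero.2 hne
  have decay := norm_integral_cexp_mul_le_inv (μ := μ * (t - t')) hαβ
    (Φ := fun s => (P s t - P s t') / (t - t')) (p := fun s => (P₁ s t - P₁ s t') / (t - t'))
    (fun s hs => ((hP t ht s hs).sub (hP t' ht' s hs)).div_const _) (fun s hs => ?_)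
    (hG t ht t' ht' hne).ofReal hb fun s hs => by rw [ha0 s t (.inl hs), zero_mul]
  · simpa only [mul_assoc μ, mul_div_cancel₀ _ htt] using decay
  · have := sub_ne_zero.2 (hP₁ t ht t' ht' hne s hs)
    rw [← Complex.ofReal_mul]
    field_simp
    simp

/-- Nondegeneracy of the mixed derivative of the phase `P` is expressed through the difference
quotients in `t` of `P₁ = ∂_s P`. -/
theorem kernelNormLE_oscillatory {α β γ κ μ G A : ℝ} (hαβ : α ≤ β) (hμ : μ ≠ 0) (hA : 0 ≤ A)
    {P P₁ : ℝ → ℝ → ℝ} {a : ℝ → ℝ → ℂ}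
    (hK : Measurable (Function.uncurry fun s t =>
      Complex.exp (Complex.I * (μ * P s t : ℝ)) * a s t))
    (ha0 : ∀ s t, s ∉ Ioo α β ∨ t ∉ Icc γ κ → a s t = 0)
    (ha : ∀ t ∈ Icc γ κ, HasC2Bound (fun s => a s t) (Icc α β) A)
    (hP : ∀ t ∈ Icc γ κ, ∀ s ∈ Icc α β, HasDerivAt (fun s => P s t) (P₁ s t) s)
    (hP₁ : ∀ t ∈ Icc γ κ, ∀ t' ∈ Icc γ κ, t ≠ t' → ∀ s ∈ Icc α β, P₁ s t ≠ P₁ s t')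
    (hG : ∀ t ∈ Icc γ κ, ∀ t' ∈ Icc γ κ, t ≠ t' →
      HasC2Bound (fun s => (t - t') / (P₁ s t - P₁ s t')) (Icc α β) G) :
    KernelNormLE (fun s t => Complex.exp (Complex.I * (μ * P s t : ℝ)) * a s t)
      (√((β - α) * (1 + 6 * G ^ 2) * 4 * Real.pi) * A * |μ| ^ (-(1 / 2) : ℝ)) := by
  have : 0 ≤ β - α := sub_nonneg.2 hαβ
  set B : ℝ := (β - α) * (1 + 6 * G ^ 2) * (4 * A * A)
  have hB : 0 ≤ B := by positivity
  have hconst : √(B * (Real.pi / |μ|)) =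
      √((β - α) * (1 + 6 * G ^ 2) * 4 * Real.pi) * A * |μ| ^ (-(1 / 2) : ℝ) := by
    rw [show B * (Real.pi / |μ|) =
      (β - α) * (1 + 6 * G ^ 2) * 4 * Real.pi * A ^ 2 * |μ|⁻¹ by ring,
      Real.sqrt_mul (by positivity), Real.sqrt_mul (by positivity), Real.sqrt_sq hA,
      Real.rpow_neg (abs_nonneg μ), ← Real.sqrt_eq_rpow, Real.sqrt_inv]
  have hbounded : ∀ s t, ‖Complex.exp (Complex.I * (μ * P s t : ℝ)) * a s t‖ ≤ A := fun s t => by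
    rw [norm_mul, norm_cexp_I_mul_ofReal, one_mul]
    by_cases hst : s ∉ Ioo α β ∨ t ∉ Icc γ κ
    · rwa [ha0 s t hst, norm_zero]
    · rw [not_or, not_not, not_not] at hst
      exact (ha t hst.2).norm_le (Ioo_subset_Icc_self hst.1)
  have hsupp : IsBoundedKernelOn (fun s t => Complex.exp (Complex.I * (μ * P s t : ℝ)) * a s t)
      (Ioo α β) (Icc γ κ) :=
    ⟨hK, ⟨A, hbounded⟩, measurableSet_Ioo, measurableSet_Icc, by simp, by simp,
      fun s hs t => by rw [ha0 s t (.inl hs), mul_zero],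
      fun s t ht => by rw [ha0 s t (.inr ht), mul_zero]⟩
  have hrow := lintegral_inv_one_add_sq_mul_sub hB hμ
  rw [← hconst]
  refine hsupp.kernelNormLE_sqrt
    (H := fun t t' => ENNReal.ofReal (B * (1 + (μ * (t - t')) ^ 2)⁻¹)) (by fun_prop)
    (by positivity) (fun t t' => ?_) (fun t => (hrow t).le) fun t' => ?_
  · rw [← ofReal_norm]
    exact ENNReal.ofReal_le_ofReal
      (norm_integral_oscillatory_mul_conj_le hαβ ha0 ha hP hP₁ hG t t')
  · refine Eq.le (Eq.trans ?_ (hrow t'))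
    congr with t
    rw [← neg_sub t' t, mul_neg, neg_sq]

end OneDimensional

section Lines

variable {E G : Type*} [NormedAddCommGroup E] [NormedSpace ℝ E] [NormedAddCommGroup G]
  [NormedSpace ℝ G]

theorem contDiff_fderiv_const_apply {F : E → G} {n : ℕ} (hF : ContDiff ℝ (n + 1 : ℕ) F) (v : E) :
    ContDiff ℝ n fun p => fderiv ℝ F p v :=
  (hF.fderiv_right (by norm_cast)).clm_apply contDiff_const

theorem hasDerivAt_comp_line {F : E → G} (hF : Differentiable ℝ F) (u v : E) (t : ℝ) :
    HasDerivAt (fun t => F (u + t • v)) (fderiv ℝ F (u + t • v) v) t := by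
  have hline : HasDerivAt (fun t : ℝ => u + t • v) v t := by
    simpa using ((hasDerivAt_id t).smul_const v).const_add u
  exact (hF _).hasFDerivAt.comp_hasDerivAt t hline

theorem exists_hasC2Bound_comp_line {F : E → G} (hF : ContDiff ℝ 2 F) {Q : Set E}
    (hQ : IsCompact Q) (v : E) :
    ∃ B, 0 ≤ B ∧ ∀ (u : E) (s : Set ℝ), (∀ t ∈ s, u + t • v ∈ Q) →
      HasC2Bound (fun t => F (u + t • v)) s B := by
  have hF₁ : ContDiff ℝ 1 fun p => fderiv ℝ F p v := contDiff_fderiv_const_apply (n := 1) hF v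
  have hF₂ : ContDiff ℝ 0 fun p => fderiv ℝ (fun p => fderiv ℝ F p v) p v :=
    contDiff_fderiv_const_apply (n := 0) hF₁ v
  obtain ⟨B₀, hB₀⟩ := hQ.exists_bound_of_continuousOn hF.continuous.continuousOn
  obtain ⟨B₁, hB₁⟩ := hQ.exists_bound_of_continuousOn hF₁.continuous.continuousOn
  obtain ⟨B₂, hB₂⟩ := hQ.exists_bound_of_continuousOn hF₂.continuous.continuousOn
  refine ⟨max 0 (max B₀ (max B₁ B₂)), le_max_left _ _, fun u s hs =>
    ⟨fun t => fderiv ℝ F (u + t • v) v, fun t => fderiv ℝ (fun p => fderiv ℝ F p v) (u + t • v) v,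
      fun t _ => ⟨hasDerivAt_comp_line (hF.differentiable two_ne_zero) u v t,
        hasDerivAt_comp_line (hF₁.differentiable one_ne_zero) u v t⟩,
      (hF₂.continuous.comp (by fun_prop)).continuousOn, fun t ht => ?_⟩⟩
  have h₀ := hB₀ _ (hs t ht)
  have h₁ := hB₁ _ (hs t ht)
  have h₂ := hB₂ _ (hs t ht)
  simp [h₀, h₁, h₂]

theorem exists_abs_slope_le {F : E → ℝ} (hF : ContDiff ℝ 1 F) {Q : Set E} (hQ : IsCompact Q)
    (hQc : Convex ℝ Q) (w : E) :
    ∃ B, 0 ≤ B ∧ ∀ (u : E) (t t' : ℝ), t ≠ t' → u + t • w ∈ Q → u + t' • w ∈ Q →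
      |(F (u + t • w) - F (u + t' • w)) / (t - t')| ≤ B := by
  obtain ⟨K, hK⟩ := hF.contDiffOn.exists_lipschitzOnWith one_ne_zero hQc hQ
  refine ⟨K * ‖w‖, by positivity, fun u t t' hne ht ht' => ?_⟩
  have hlip := hK.dist_le_mul _ ht _ ht'
  rw [Real.dist_eq, dist_eq_norm, add_sub_add_left_eq_sub, ← sub_smul, norm_smul,
    Real.norm_eq_abs] at hlip
  rw [abs_div, div_le_iff₀ (abs_pos.2 (sub_ne_zero.2 hne))]
  linarith

theorem le_abs_slope_of_le_abs_fderiv {F : E → ℝ} (hF : Differentiable ℝ F) {Q : Set E}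
    (hQc : Convex ℝ Q) {w : E} {c : ℝ} (hc : ∀ p ∈ Q, c ≤ |fderiv ℝ F p w|) {u : E} {t t' : ℝ}
    (hne : t ≠ t') (ht : u + t • w ∈ Q) (ht' : u + t' • w ∈ Q) :
    c ≤ |(F (u + t • w) - F (u + t' • w)) / (t - t')| := by
  wlog hlt : t' < t generalizing t t'
  · rw [← neg_sub (F (u + t' • w)), ← neg_sub t', neg_div_neg_eq]
    exact this hne.symm ht' ht (hne.lt_of_le (not_lt.1 hlt))
  obtain ⟨τ, hτ, hslope⟩ := exists_hasDerivAt_eq_slope (fun t => F (u + t • w))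
    (fun t => fderiv ℝ F (u + t • w) w) hlt (hF.continuous.comp (by fun_prop)).continuousOn
    fun τ _ => hasDerivAt_comp_line hF u w τ
  rw [← hslope]
  have hline : Convex ℝ {t : ℝ | u + t • w ∈ Q} :=
    (hQc.translate_preimage_right u).is_linear_preimage (IsLinearMap.isLinearMap_smul' w)
  exact hc _ (hline.ordConnected.out ht' ht (Ioo_subset_Icc_self hτ))

theorem exists_hasC2Bound_inv_slope {F : E → ℝ} (hF : ContDiff ℝ 3 F) {Q : Set E}
    (hQ : IsCompact Q) (hQc : Convex ℝ Q) (v w : E) {c : ℝ} (hc : 0 < c)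
    (hcF : ∀ p ∈ Q, c ≤ |fderiv ℝ F p w|) :
    ∃ G, ∀ (u : E) (s : Set ℝ) (t t' : ℝ), t ≠ t' → (∀ r ∈ s, u + t • w + r • v ∈ Q) →
      (∀ r ∈ s, u + t' • w + r • v ∈ Q) →
      (∀ r ∈ s, F (u + t • w + r • v) ≠ F (u + t' • w + r • v)) ∧
      HasC2Bound (fun r => (t - t') / (F (u + t • w + r • v) - F (u + t' • w + r • v))) s G := by
  have hF₁ : ContDiff ℝ 2 fun p => fderiv ℝ F p v := contDiff_fderiv_const_apply (n := 2) hF v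
  have hF₂ : ContDiff ℝ 1 fun p => fderiv ℝ (fun p => fderiv ℝ F p v) p v :=
    contDiff_fderiv_const_apply (n := 1) hF₁ v
  obtain ⟨B₀, hB₀, hslope₀⟩ := exists_abs_slope_le (hF.of_le (by norm_num)) hQ hQc w
  obtain ⟨B₁, hB₁, hslope₁⟩ := exists_abs_slope_le (hF₁.of_le (by norm_num)) hQ hQc w
  obtain ⟨B₂, hB₂, hslope₂⟩ := exists_abs_slope_le hF₂ hQ hQc w
  set B := B₀ + B₁ + B₂
  refine ⟨1 / c + B / c ^ 2 + 2 * B ^ 2 / c ^ 3, fun u s t t' hne ht ht' => ?_⟩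
  simp only [add_right_comm u _ (_ • v)] at ht ht'
  have hlower : ∀ r ∈ s, c ≤ |(F (u + t • w + r • v) - F (u + t' • w + r • v)) / (t - t')| :=
    fun r hr => by
      simp only [add_right_comm u _ (r • v)]
      exact le_abs_slope_of_le_abs_fderiv (hF.differentiable three_ne_zero) hQc hcF hne
        (ht r hr) (ht' r hr)
  have hslope : HasC2Bound (fun r => (F (u + t • w + r • v) - F (u + t' • w + r • v)) / (t - t'))
      s B := by
    refine ⟨_, _, fun r _ =>
      ⟨((hasDerivAt_comp_line (hF.differentiable three_ne_zero) (u + t • w) v r).sub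
        (hasDerivAt_comp_line (hF.differentiable three_ne_zero) (u + t' • w) v r)).div_const _,
      ((hasDerivAt_comp_line (hF₁.differentiable two_ne_zero) (u + t • w) v r).sub
        (hasDerivAt_comp_line (hF₁.differentiable two_ne_zero) (u + t' • w) v r)).div_const _⟩,
      ?_, fun r hr => ?_⟩
    · have := hF₂.continuous
      fun_prop
    · simp only [add_right_comm u _ (r • v), Real.norm_eq_abs]
      exact ⟨(hslope₀ _ _ _ hne (ht r hr) (ht' r hr)).trans (by linarith),
        (hslope₁ _ _ _ hne (ht r hr) (ht' r hr)).trans (by linarith),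
        (hslope₂ _ _ _ hne (ht r hr) (ht' r hr)).trans (by linarith)⟩
  refine ⟨fun r hr heq => ?_, by simpa only [inv_div] using hslope.inv hc hlower⟩
  simpa [heq] using hc.trans_le (hlower r hr)

end Lines

section Local

/-- The kernel `e^{iμS} |D|^z a` as a function of the joint variable, for an arbitrary phase `S`,
damping factor `D` and amplitude `a`. -/
def dampedDensity {E : Type*} (S D : E → ℝ) (a : E → ℂ) (μ : ℝ) (z : ℂ) (p : E) : ℂ :=
  Complex.exp (Complex.I * ((μ * S p : ℝ) : ℂ)) * ((|D p| : ℝ) : ℂ) ^ z * a p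

theorem measurable_dampedDensity {E : Type*} [MeasurableSpace E] {S D : E → ℝ} {a : E → ℂ}
    (hS : Measurable S) (hD : Measurable D) (ha : Measurable a) (μ : ℝ) (z : ℂ) :
    Measurable (dampedDensity S D a μ z) := by
  have hphase : Measurable fun p => Complex.exp (Complex.I * ((μ * S p : ℝ) : ℂ)) := by fun_prop
  exact (hphase.mul (hD.abs.complex_ofReal.pow_const z)).mul ha

variable {E W : Type*} [NormedAddCommGroup E] [NormedSpace ℝ E] [NormedAddCommGroup W]
  [NormedSpace ℝ W]

theorem exists_hasC2Bound_damping {D : E → ℝ} (hD : ContDiff ℝ 2 D) {h : W × E → ℂ}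
    (hh : ContDiff ℝ 2 h) {Q : Set E} (hQ : IsCompact Q) {R : Set W} (hR : IsCompact R) {c : ℝ}
    (hc : 0 < c) (hDc : ∀ p ∈ Q, c ≤ |D p|) (v : E) (σ : ℝ) :
    ∃ A, 0 ≤ A ∧ ∀ r ∈ R, ∀ z : ℂ, |z.re| ≤ σ → ∀ (u : E) (s : Set ℝ),
      (∀ t ∈ s, u + t • v ∈ Q) →
      HasC2Bound (fun t => ((|D (u + t • v)| : ℝ) : ℂ) ^ z * h (r, u + t • v)) s
        (A * (1 + ‖z‖) ^ 2) := by
  obtain ⟨B, hB, hDB⟩ := exists_hasC2Bound_comp_line hD hQ v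
  obtain ⟨H, hH, hhH⟩ := exists_hasC2Bound_comp_line hh (hR.prod hQ) (0, v)
  refine ⟨4 * (Real.exp (σ * (B + 1 / c + B / c + (B / c) ^ 2)) *
    (1 + (B + 1 / c + B / c + (B / c) ^ 2)) ^ 2) * H, by positivity, fun r hr z hz u s hs => ?_⟩
  have hline : HasC2Bound (fun t => h (r, u + t • v)) s H := by
    simpa using hhH (r, u) s fun t ht => by simpa using ⟨hr, hs t ht⟩
  refine (((hDB u s hs).abs_cpow hB hc (fun t ht => hDc _ (hs t ht)) hz).mul hline).mono
    (le_of_eq ?_)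
  ring

theorem exists_kernelNormLE_plane {S D : E → ℝ} (hS : ContDiff ℝ 4 S) (hD : ContDiff ℝ 2 D)
    {h : W × E → ℂ} (hh : ContDiff ℝ 2 h) {Q : Set E} (hQ : IsCompact Q) (hQc : Convex ℝ Q)
    {R : Set W} (hR : IsCompact R) {c : ℝ} (hc : 0 < c) (hDc : ∀ p ∈ Q, c ≤ |D p|) {v w : E}
    (hSc : ∀ p ∈ Q, c ≤ |fderiv ℝ (fun q => fderiv ℝ S q v) p w|) {ℓ : ℝ} (hℓ : 0 ≤ ℓ) (σ : ℝ) :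
    ∃ C, 0 ≤ C ∧ ∀ r ∈ R, ∀ μ : ℝ, μ ≠ 0 → ∀ z : ℂ, |z.re| ≤ σ → ∀ (u : E) (α γ κ : ℝ),
      (∀ s ∈ Icc α (α + ℓ), ∀ t ∈ Icc γ κ, u + t • w + s • v ∈ Q) →
      (∀ s t : ℝ, s ∉ Ioo α (α + ℓ) ∨ t ∉ Icc γ κ → h (r, u + t • w + s • v) = 0) →
      KernelNormLE
        (fun s t : ℝ => dampedDensity S D (fun p => h (r, p)) μ z (u + t • w + s • v))
        (C * (1 + ‖z‖) ^ 2 * |μ| ^ (-(1 / 2) : ℝ)) := by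
  have hF : ContDiff ℝ 3 fun p => fderiv ℝ S p v := contDiff_fderiv_const_apply (n := 3) hS v
  obtain ⟨A, hA, hamp⟩ := exists_hasC2Bound_damping hD hh hQ hR hc hDc v σ
  obtain ⟨G, hG⟩ := exists_hasC2Bound_inv_slope hF hQ hQc v w hc hSc
  refine ⟨√(ℓ * (1 + 6 * G ^ 2) * 4 * Real.pi) * A, by positivity,
    fun r hr μ hμ z hz u α γ κ hmem hzero => ?_⟩
  have hmeas : Measurable (Function.uncurry fun s t : ℝ =>
      dampedDensity S D (fun p => h (r, p)) μ z (u + t • w + s • v)) := by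
    have hplane : Continuous fun q : ℝ × ℝ => u + q.2 • w + q.1 • v := by fun_prop
    have hh' : Continuous fun p => h (r, p) := hh.continuous.comp (by fun_prop)
    exact measurable_dampedDensity (hS.continuous.comp hplane).measurable
      (hD.continuous.comp hplane).measurable (hh'.comp hplane).measurable μ z
  simp only [dampedDensity, mul_assoc (Complex.exp _)] at hmeas ⊢
  refine (kernelNormLE_oscillatory (α := α) (β := α + ℓ) (γ := γ) (κ := κ)
    (P := fun s t => S (u + t • w + s • v))
    (P₁ := fun s t => fderiv ℝ S (u + t • w + s • v) v)
    (a := fun s t => ((|D (u + t • w + s • v)| : ℝ) : ℂ) ^ z * h (r, u + t • w + s • v))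
    (G := G) (le_add_of_nonneg_right hℓ) hμ (A := A * (1 + ‖z‖) ^ 2) (by positivity) hmeas
    (fun s t hst => by rw [hzero s t hst, mul_zero])
    (fun t ht => hamp r hr z hz _ _ fun s hs => hmem s hs t ht)
    (fun t _ s _ => hasDerivAt_comp_line (hS.differentiable four_ne_zero) _ v s)
    (fun t ht t' ht' hne => ?_) fun t ht t' ht' hne => ?_).mono (le_of_eq ?_)
  · exact (hG u _ t t' hne (fun s hs => hmem s hs t ht) fun s hs => hmem s hs t' ht').1
  · exact (hG u _ t t' hne (fun s hs => hmem s hs t ht) fun s hs => hmem s hs t' ht').2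
  · rw [add_sub_cancel_left]
    ring

end Local

section Ball

variable {m n : ℕ}

theorem exists_norm_dampedDensity_le {E : Type*} [TopologicalSpace E] {S D : E → ℝ} {a : E → ℂ}
    {Q : Set E} (hQ : IsCompact Q) (hS : Continuous S) (hD : Continuous D) (ha : Continuous a)
    (hD0 : ∀ p ∈ Q, D p ≠ 0) (ha0 : ∀ p ∉ Q, a p = 0) (μ : ℝ) (z : ℂ) :
    ∃ M, ∀ p, ‖dampedDensity S D a μ z p‖ ≤ M := by
  have hpow : ContinuousOn (fun p => ((|D p| : ℝ) : ℂ) ^ z) Q :=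
    ContinuousOn.cpow (by fun_prop) continuousOn_const fun p hp =>
      Complex.ofReal_mem_slitPlane.2 (abs_pos.2 (hD0 p hp))
  have hphase : Continuous fun p => Complex.exp (Complex.I * ((μ * S p : ℝ) : ℂ)) := by fun_prop
  obtain ⟨M, hM⟩ := hQ.exists_bound_of_continuousOn
    ((hphase.continuousOn.mul hpow).mul ha.continuousOn)
  refine ⟨max M 0, fun p => ?_⟩
  by_cases hp : p ∈ Q
  · exact (hM p hp).trans (le_max_left _ _)
  · simp [dampedDensity, ha0 p hp]

theorem insertNth_eq_add_smul_single (i : Fin (m + 1)) (s : ℝ) (x : Fin m → ℝ) :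
    (i.insertNth s x : Fin (m + 1) → ℝ) = i.insertNth 0 x + s • Pi.single i 1 := by
  ext k
  rcases Fin.eq_self_or_eq_succAbove i k with rfl | ⟨l, rfl⟩ <;> simp

theorem insertNth_mem_closedBall {i : Fin (m + 1)} {s ε : ℝ} (hε : 0 ≤ ε) {x : Fin m → ℝ}
    {x₀ : Fin (m + 1) → ℝ} :
    (i.insertNth s x : Fin (m + 1) → ℝ) ∈ Metric.closedBall x₀ ε ↔
      s ∈ Metric.closedBall (x₀ i) ε ∧ x ∈ Metric.closedBall (i.removeNth x₀) ε := by
  simp [Metric.mem_closedBall, dist_pi_le_iff hε, Fin.forall_iff_succAbove i, Fin.removeNth]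

theorem insertNth_mem_ball {i : Fin (m + 1)} {s ε : ℝ} (hε : 0 < ε) {x : Fin m → ℝ}
    {x₀ : Fin (m + 1) → ℝ} :
    (i.insertNth s x : Fin (m + 1) → ℝ) ∈ Metric.ball x₀ ε ↔
      s ∈ Metric.ball (x₀ i) ε ∧ x ∈ Metric.ball (i.removeNth x₀) ε := by
  simp [Metric.mem_ball, dist_pi_lt_iff hε, Fin.forall_iff_succAbove i, Fin.removeNth]

theorem KernelNormLE.of_insertNth (i : Fin (m + 1)) (j : Fin (n + 1))
    {K : (Fin (m + 1) → ℝ) → (Fin (n + 1) → ℝ) → ℂ} {A : ℝ}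
    (h : KernelNormLE (fun (x : ℝ × (Fin m → ℝ)) (y : ℝ × (Fin n → ℝ)) =>
      K (i.insertNth x.1 x.2) (j.insertNth y.1 y.2)) A) : KernelNormLE K A := by
  have hmap : ∀ {k} (i : Fin (k + 1)), (volume : Measure (ℝ × (Fin k → ℝ))).map
      (MeasurableEquiv.piFinSuccAbove (fun _ => ℝ) i).symm = ENNReal.ofReal 1 • volume :=
    fun i => by simpa using (volume_preserving_piFinSuccAbove (fun _ => ℝ) i).symm.map_eq
  simpa using KernelNormLE.of_measurableEquiv _ _ one_pos one_pos (hmap i) (hmap j) h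

theorem isBoundedKernelOn_insertNth {i : Fin (m + 1)} {j : Fin (n + 1)}
    {K : (Fin (m + 1) → ℝ) → (Fin (n + 1) → ℝ) → ℂ} (hK : Measurable (Function.uncurry K)) {M : ℝ}
    (hM : ∀ x y, ‖K x y‖ ≤ M) {v₀ : (Fin (m + 1) → ℝ) × (Fin (n + 1) → ℝ)} {ε : ℝ} (hε : 0 ≤ ε)
    (hK0 : ∀ x y, (x, y) ∉ Metric.closedBall v₀ ε → K x y = 0) :
    IsBoundedKernelOn (fun (x : ℝ × (Fin m → ℝ)) (y : ℝ × (Fin n → ℝ)) =>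
        K (i.insertNth x.1 x.2) (j.insertNth y.1 y.2))
      (Metric.closedBall (v₀.1 i) ε ×ˢ Metric.closedBall (i.removeNth v₀.1) ε)
      (Metric.closedBall (v₀.2 j) ε ×ˢ Metric.closedBall (j.removeNth v₀.2) ε) := by
  have hmeas : ∀ {k} (i : Fin (k + 1)),
      Measurable fun x : ℝ × (Fin k → ℝ) => (i.insertNth x.1 x.2 : Fin (k + 1) → ℝ) := fun i =>
    (MeasurableEquiv.piFinSuccAbove (fun _ => ℝ) i).symm.measurable
  have hcompact : ∀ {k} (s : ℝ) (x : Fin k → ℝ),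
      IsCompact (Metric.closedBall s ε ×ˢ Metric.closedBall x ε) := fun s x =>
    (isCompact_closedBall _ _).prod (isCompact_closedBall _ _)
  exact {
    measurable := hK.comp (((hmeas i).comp measurable_fst).prodMk ((hmeas j).comp measurable_snd))
    bounded := ⟨M, fun _ _ => hM _ _⟩
    measurableSet_left := (hcompact _ _).measurableSet
    measurableSet_right := (hcompact _ _).measurableSet
    volume_left_ne_top := (hcompact _ _).measure_ne_top
    volume_right_ne_top := (hcompact _ _).measure_ne_top
    eq_zero_left := fun x hx y => hK0 _ _ fun hxy => by
      rw [← closedBall_prod_same] at hxy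
      exact hx ((insertNth_mem_closedBall hε).1 hxy.1)
    eq_zero_right := fun x y hy => hK0 _ _ fun hxy => by
      rw [← closedBall_prod_same] at hxy
      exact hy ((insertNth_mem_closedBall hε).1 hxy.2) }

theorem kernelNormLE_of_insertNth_slices {i : Fin (m + 1)} {j : Fin (n + 1)}
    {K : (Fin (m + 1) → ℝ) → (Fin (n + 1) → ℝ) → ℂ} (hK : Measurable (Function.uncurry K)) {M : ℝ}
    (hM : ∀ x y, ‖K x y‖ ≤ M) {v₀ : (Fin (m + 1) → ℝ) × (Fin (n + 1) → ℝ)} {ε : ℝ} (hε : 0 ≤ ε)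
    (hK0 : ∀ x y, (x, y) ∉ Metric.closedBall v₀ ε → K x y = 0) {A : ℝ}
    (h : ∀ x₂ ∈ Metric.closedBall (i.removeNth v₀.1) ε,
      ∀ y₂ ∈ Metric.closedBall (j.removeNth v₀.2) ε,
        KernelNormLE (fun s t : ℝ => K (i.insertNth s x₂) (j.insertNth t y₂)) A) :
    KernelNormLE K (√(volume (Metric.closedBall (i.removeNth v₀.1) ε)).toReal *
      √(volume (Metric.closedBall (j.removeNth v₀.2) ε)).toReal * A) := by
  have hvol : ∀ {k} (x : Fin k → ℝ), volume (Metric.closedBall x ε) ≤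
      ENNReal.ofReal (√(volume (Metric.closedBall x ε)).toReal ^ 2) := fun x => by
    rw [Real.sq_sqrt ENNReal.toReal_nonneg,
      ENNReal.ofReal_toReal (isCompact_closedBall _ _).measure_ne_top]
  exact KernelNormLE.of_insertNth i j <|
    (isBoundedKernelOn_insertNth hK hM hε hK0).kernelNormLE_of_slices measurableSet_closedBall
      measurableSet_closedBall (Real.sqrt_nonneg _) (Real.sqrt_nonneg _) (hvol _) (hvol _) h

theorem exists_kernelNormLE_ball {W : Type*} [NormedAddCommGroup W] [NormedSpace ℝ W]
    {S D : (Fin (m + 1) → ℝ) × (Fin (n + 1) → ℝ) → ℝ} (hS : ContDiff ℝ 4 S) (hD : ContDiff ℝ 2 D)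
    {i : Fin (m + 1)} {j : Fin (n + 1)} {v₀ : (Fin (m + 1) → ℝ) × (Fin (n + 1) → ℝ)} {ε c : ℝ}
    (hε : 0 < ε) (hc : 0 < c) (hDc : ∀ p ∈ Metric.closedBall v₀ ε, c ≤ |D p|)
    (hSc : ∀ p ∈ Metric.closedBall v₀ ε,
      c ≤ |fderiv ℝ (fun q => fderiv ℝ S q (Pi.single i 1, 0)) p (0, Pi.single j 1)|)
    {h : W × (Fin (m + 1) → ℝ) × (Fin (n + 1) → ℝ) → ℂ} (hh : ContDiff ℝ 2 h) {R : Set W}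
    (hR : IsCompact R) (hh0 : ∀ r, ∀ p ∉ Metric.ball v₀ ε, h (r, p) = 0) (σ : ℝ) :
    ∃ C, 0 ≤ C ∧ ∀ r ∈ R, ∀ μ : ℝ, μ ≠ 0 → ∀ z : ℂ, |z.re| ≤ σ →
      KernelNormLE (fun x y => dampedDensity S D (fun p => h (r, p)) μ z (x, y))
        (C * (1 + ‖z‖) ^ 2 * |μ| ^ (-(1 / 2) : ℝ)) := by
  obtain ⟨C, hC, hplane⟩ := exists_kernelNormLE_plane hS hD hh (isCompact_closedBall v₀ ε)
    (convex_closedBall v₀ ε) hR hc hDc hSc (ℓ := 2 * ε) (by positivity) σ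
  refine ⟨√(volume (Metric.closedBall (i.removeNth v₀.1) ε)).toReal *
    √(volume (Metric.closedBall (j.removeNth v₀.2) ε)).toReal * C, by positivity,
    fun r hr μ hμ z hz => ?_⟩
  have hh' : Continuous fun p => h (r, p) := hh.continuous.comp (by fun_prop)
  have hh0' : ∀ p ∉ Metric.closedBall v₀ ε, h (r, p) = 0 := fun p hp =>
    hh0 r p fun hp' => hp (Metric.ball_subset_closedBall hp')
  obtain ⟨M, hM⟩ := exists_norm_dampedDensity_le (isCompact_closedBall v₀ ε) hS.continuous
    hD.continuous hh' (fun p hp hp0 => by simpa [hp0] using hc.trans_le (hDc p hp)) hh0' μ z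
  refine (kernelNormLE_of_insertNth_slices (i := i) (j := j) (v₀ := v₀)
    (K := fun x y => dampedDensity S D (fun p => h (r, p)) μ z (x, y))
    (A := C * (1 + ‖z‖) ^ 2 * |μ| ^ (-(1 / 2) : ℝ))
    (measurable_dampedDensity hS.continuous.measurable hD.continuous.measurable hh'.measurable μ z)
    (fun x y => hM (x, y)) hε.le (fun x y hxy => by simp [dampedDensity, hh0' _ hxy])
    fun x₂ hx₂ y₂ hy₂ => ?_).mono (le_of_eq (by ring))
  have hline : ∀ s t : ℝ, ((i.insertNth s x₂, j.insertNth t y₂) :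
      (Fin (m + 1) → ℝ) × (Fin (n + 1) → ℝ)) = (i.insertNth 0 x₂, j.insertNth 0 y₂) +
        t • (0, Pi.single j 1) + s • (Pi.single i 1, 0) := fun s t => by
    simp [insertNth_eq_add_smul_single i s, insertNth_eq_add_smul_single j t]
  have hend : ∀ a : ℝ, a - ε + 2 * ε = a + ε := fun a => by ring
  have hslice := hplane r hr μ hμ z hz (i.insertNth 0 x₂, j.insertNth 0 y₂) (v₀.1 i - ε)
    (v₀.2 j - ε) (v₀.2 j + ε)
  simp only [← hline, hend, ← Real.closedBall_eq_Icc, ← Real.ball_eq_Ioo] at hslice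
  refine hslice (fun s hs t ht => ?_) fun s t hst => hh0 r _ fun hmem => ?_
  · rw [← closedBall_prod_same]
    exact ⟨(insertNth_mem_closedBall hε.le).2 ⟨hs, hx₂⟩,
      (insertNth_mem_closedBall hε.le).2 ⟨ht, hy₂⟩⟩
  · rw [← ball_prod_same] at hmem
    exact hst.elim (· ((insertNth_mem_ball hε).1 hmem.1).1)
      (· (Metric.ball_subset_closedBall ((insertNth_mem_ball hε).1 hmem.2).1))

end Ball

section Polynomial

theorem hasFDerivAt_eval {σ : Type*} [Fintype σ] (P : MvPolynomial σ ℝ) (v : σ → ℝ) :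
    HasFDerivAt (fun v => MvPolynomial.eval v P)
      (∑ i, MvPolynomial.eval v (MvPolynomial.pderiv i P) •
        (ContinuousLinearMap.proj i : (σ → ℝ) →L[ℝ] ℝ)) v := by
  classical
  induction P using MvPolynomial.induction_on with
  | C a => simpa using hasFDerivAt_const a v
  | add p q hp hq => simpa [add_smul, Finset.sum_add_distrib] using hp.fun_add hq
  | mul_X p k hp =>
    have hX : HasFDerivAt (fun v : σ → ℝ => v k)
        (ContinuousLinearMap.proj k : (σ → ℝ) →L[ℝ] ℝ) v := hasFDerivAt_apply k v
    simpa [MvPolynomial.pderiv_X, Pi.single_apply, apply_ite, add_smul, Finset.sum_add_distrib,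
      Finset.smul_sum, smul_smul, mul_comm] using hp.fun_mul hX

theorem pderiv_pderiv_comm {R σ : Type*} [CommRing R] (i j : σ) (P : MvPolynomial σ R) :
    MvPolynomial.pderiv i (MvPolynomial.pderiv j P) =
      MvPolynomial.pderiv j (MvPolynomial.pderiv i P) := by
  classical
  have hcomm : ⁅(MvPolynomial.pderiv i : Derivation R (MvPolynomial σ R) (MvPolynomial σ R)),
      (MvPolynomial.pderiv j : Derivation R (MvPolynomial σ R) (MvPolynomial σ R))⁆ = 0 := by
    refine MvPolynomial.derivation_ext fun k => ?_
    rw [Derivation.commutator_apply, MvPolynomial.pderiv_X, MvPolynomial.pderiv_X]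
    simp only [Pi.single_apply]
    split_ifs <;> simp
  rw [← sub_eq_zero, ← Derivation.commutator_apply, hcomm, Derivation.zero_apply]

variable {m n : ℕ}

theorem contDiff_polyEval (P : MvPolynomial (Fin m ⊕ Fin n) ℝ) {k : ℕ∞ω} :
    ContDiff ℝ k fun p : (Fin m → ℝ) × (Fin n → ℝ) => polyEval P p.1 p.2 :=
  ((AnalyticOnNhd.eval_mvPolynomial P).contDiff.of_le le_top).comp <|
    (ContinuousLinearEquiv.sumPiEquivProdPi ℝ (Fin m) (Fin n) fun _ => ℝ).symm.contDiff

theorem fderiv_polyEval (P : MvPolynomial (Fin m ⊕ Fin n) ℝ) (p u : (Fin m → ℝ) × (Fin n → ℝ)) :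
    fderiv ℝ (fun q => polyEval P q.1 q.2) p u =
      ∑ k, polyEval (MvPolynomial.pderiv k P) p.1 p.2 * Sum.elim u.1 u.2 k := by
  let e := (ContinuousLinearEquiv.sumPiEquivProdPi ℝ (Fin m) (Fin n) fun _ => ℝ).symm
  have h := ((hasFDerivAt_eval P (e p)).comp p e.hasFDerivAt).fderiv
  calc fderiv ℝ (fun q => polyEval P q.1 q.2) p u
      = ∑ k, MvPolynomial.eval (e p) (MvPolynomial.pderiv k P) * e u k := by
        refine (congrArg (· u) h).trans ?_
        simp
    _ = _ := Finset.sum_congr rfl fun k _ => by cases k <;> rfl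

theorem fderiv_fderiv_polyEval (P : MvPolynomial (Fin m ⊕ Fin n) ℝ) (i : Fin m) (j : Fin n)
    (p : (Fin m → ℝ) × (Fin n → ℝ)) :
    fderiv ℝ (fun q => fderiv ℝ (fun q => polyEval P q.1 q.2) q (Pi.single i 1, 0)) p
        (0, Pi.single j 1) =
      polyEval (MvPolynomial.pderiv (Sum.inl i) (MvPolynomial.pderiv (Sum.inr j) P)) p.1 p.2 := by
  simp [fderiv_polyEval, Pi.single_apply, pderiv_pderiv_comm (Sum.inl i)]

end Polynomial

section Annulus

variable {m n : ℕ} {S D : MvPolynomial (Fin m ⊕ Fin n) ℝ}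

theorem continuous_polyEval (P : MvPolynomial (Fin m ⊕ Fin n) ℝ) :
    Continuous fun p : (Fin m → ℝ) × (Fin n → ℝ) => polyEval P p.1 p.2 :=
  (contDiff_polyEval P (k := 0)).continuous

theorem exists_pos_forall_closedBall_le_abs {X : Type*} [PseudoMetricSpace X] {f g : X → ℝ}
    {x : X} (hf : ContinuousAt f x) (hg : ContinuousAt g x) (hf0 : f x ≠ 0) (hg0 : g x ≠ 0) :
    ∃ ε > 0, ∃ c > 0, ∀ y ∈ Metric.closedBall x ε, c ≤ |f y| ∧ c ≤ |g y| := by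
  obtain ⟨c, hc, hcf⟩ := exists_between (lt_min (abs_pos.2 hf0) (abs_pos.2 hg0))
  have hev : ∀ᶠ y in 𝓝 x, c ≤ |f y| ∧ c ≤ |g y| :=
    (hf.abs.eventually_const_le (hcf.trans_le (min_le_left _ _))).and
      (hg.abs.eventually_const_le (hcf.trans_le (min_le_right _ _)))
  obtain ⟨ε, hε, hsub⟩ := Metric.nhds_basis_closedBall.eventually_iff.1 hev
  exact ⟨ε, hε, c, hc, fun y hy => hsub hy⟩

theorem RankOne.exists_pderiv_pderiv_ne_zero (hS : RankOne S)
    {v : (Fin m → ℝ) × (Fin n → ℝ)} (hv : v ≠ 0) :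
    ∃ i j, polyEval (MvPolynomial.pderiv (Sum.inl i) (MvPolynomial.pderiv (Sum.inr j) S))
      v.1 v.2 ≠ 0 := by
  contrapose! hv
  exact Prod.ext_iff.2 (hS _ _ hv)

theorem NonvanishingAwayFromOrigin.polyEval_ne_zero (hD : NonvanishingAwayFromOrigin D)
    {v : (Fin m → ℝ) × (Fin n → ℝ)} (hv : v ≠ 0) : polyEval D v.1 v.2 ≠ 0 :=
  fun h => hv (Prod.ext_iff.2 (hD _ _ h))

theorem exists_kernelNormLE_near (hS : RankOne S) (hD : NonvanishingAwayFromOrigin D)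
    {v₀ : (Fin m → ℝ) × (Fin n → ℝ)} (hv₀ : v₀ ≠ 0) {W : Type*} [NormedAddCommGroup W]
    [NormedSpace ℝ W] {R : Set W} (hR : IsCompact R) (σ : ℝ) :
    ∃ ε > 0, ∀ h : W × (Fin m → ℝ) × (Fin n → ℝ) → ℂ, ContDiff ℝ 2 h →
      (∀ r, ∀ v ∉ Metric.ball v₀ ε, h (r, v) = 0) →
      ∃ C, 0 ≤ C ∧ ∀ r ∈ R, ∀ μ : ℝ, μ ≠ 0 → ∀ z : ℂ, |z.re| ≤ σ →
        KernelNormLE (dampedKernel S D (fun v => h (r, v)) μ z)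
          (C * (1 + ‖z‖) ^ 2 * |μ| ^ (-(1 / 2) : ℝ)) := by
  obtain ⟨i, j, hij⟩ := hS.exists_pderiv_pderiv_ne_zero hv₀
  obtain _ | m := m
  · exact i.elim0
  obtain _ | n := n
  · exact j.elim0
  obtain ⟨ε, hε, c, hc, hle⟩ := exists_pos_forall_closedBall_le_abs
    (continuous_polyEval _).continuousAt (continuous_polyEval D).continuousAt hij
    (hD.polyEval_ne_zero hv₀)
  refine ⟨ε, hε, fun h hh hh0 => ?_⟩
  exact exists_kernelNormLE_ball (contDiff_polyEval S) (contDiff_polyEval D) hε hc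
    (fun p hp => (hle p hp).2)
    (fun p hp => by simpa only [fderiv_fderiv_polyEval] using (hle p hp).1) hh hR hh0 σ

theorem dampedKernel_sum {ι : Type*} (s : Finset ι) (S D : MvPolynomial (Fin m ⊕ Fin n) ℝ)
    (φ : ι → (Fin m → ℝ) × (Fin n → ℝ) → ℂ) (lam : ℝ) (z : ℂ) :
    dampedKernel S D (fun v => ∑ k ∈ s, φ k v) lam z =
      fun x y => ∑ k ∈ s, dampedKernel S D (φ k) lam z x y := by
  ext x y
  simp only [dampedKernel, Finset.mul_sum]

open scoped Manifold in
theorem exists_smooth_finite_partition {E : Type*} [NormedAddCommGroup E] [NormedSpace ℝ E]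
    [FiniteDimensional ℝ E] {K : Set E} (hK : IsCompact K) {ε : E → ℝ} (hε : ∀ v ∈ K, 0 < ε v) :
    ∃ (t : Finset E) (f : E → E → ℝ), ↑t ⊆ K ∧ (∀ p ∈ t, ContDiff ℝ ∞ (f p)) ∧
      (∀ p ∈ t, ∀ v ∉ Metric.ball p (ε p), f p v = 0) ∧ ∀ v ∈ K, ∑ p ∈ t, f p v = 1 := by
  classical
  obtain ⟨t, htK, hcov⟩ := hK.elim_nhds_subcover (fun v => Metric.ball v (ε v))
    fun v hv => Metric.ball_mem_nhds v (hε v hv)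
  obtain ⟨f, hf⟩ := SmoothPartitionOfUnity.exists_isSubordinate 𝓘(ℝ, E) hK.isClosed
    (fun p : t => Metric.ball (p : E) (ε p)) (fun p => Metric.isOpen_ball) fun v hv => by
      simpa only [mem_iUnion, Subtype.exists, exists_prop] using hcov hv
  refine ⟨t, fun p => if hp : p ∈ t then f ⟨p, hp⟩ else 0, htK, fun p hp => ?_,
    fun p hp v hv => ?_, fun v hv => ?_⟩
  · simpa [hp] using (f ⟨p, hp⟩).contMDiff.contDiff
  · simpa [hp] using image_eq_zero_of_notMem_tsupport fun h => hv (hf ⟨p, hp⟩ h)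
  · rw [← f.sum_eq_one hv, finsum_eq_sum_of_fintype, ← Finset.sum_coe_sort]
    exact Finset.sum_congr rfl fun p _ => by simp

theorem exists_kernelNormLE_annulus (hS : RankOne S) (hD : NonvanishingAwayFromOrigin D)
    {K : Set ((Fin m → ℝ) × (Fin n → ℝ))} (hK : IsCompact K) (hK0 : 0 ∉ K)
    {W : Type*} [NormedAddCommGroup W] [NormedSpace ℝ W] {R : Set W} (hR : IsCompact R)
    {h : W × (Fin m → ℝ) × (Fin n → ℝ) → ℂ} (hh : ContDiff ℝ 2 h)
    (hh0 : ∀ r, ∀ v ∉ K, h (r, v) = 0) (σ : ℝ) :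
    ∃ C, 0 ≤ C ∧ ∀ r ∈ R, ∀ μ : ℝ, μ ≠ 0 → ∀ z : ℂ, |z.re| ≤ σ →
      KernelNormLE (dampedKernel S D (fun v => h (r, v)) μ z)
        (C * (1 + ‖z‖) ^ 2 * |μ| ^ (-(1 / 2) : ℝ)) := by
  have hnear := fun v₀ (hv₀ : v₀ ∈ K) =>
    exists_kernelNormLE_near hS hD (ne_of_mem_of_not_mem hv₀ hK0) hR σ
  choose! ε hε hloc using hnear
  obtain ⟨t, f, htK, hfs, hf0, hf1⟩ := exists_smooth_finite_partition hK hε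
  have hpiece := fun p (hp : p ∈ t) => hloc p (htK hp) (fun q => (f p q.2 : ℂ) * h q)
    ((Complex.ofRealCLM.contDiff.comp
      (((hfs p hp).of_le ENat.LEInfty.out).comp contDiff_snd)).mul hh)
    fun r v hv => by simp only [hf0 p hp v hv, Complex.ofReal_zero, zero_mul]
  choose! C hC hbound using hpiece
  refine ⟨∑ p ∈ t, C p, Finset.sum_nonneg hC, fun r hr μ hμ z hz => ?_⟩
  have hdec : (fun v => h (r, v)) = fun v => ∑ p ∈ t, (f p v : ℂ) * h (r, v) := by
    ext v
    rw [← Finset.sum_mul, ← Complex.ofReal_sum]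
    by_cases hv : v ∈ K
    · rw [hf1 v hv, Complex.ofReal_one, one_mul]
    · rw [hh0 r v hv, mul_zero]
  rw [hdec, dampedKernel_sum, Finset.sum_mul, Finset.sum_mul]
  refine KernelNormLE.sum t (fun p hp => hbound p hp r hr μ hμ z hz) fun p hp => ?_
  have := hC p hp
  positivity

end Annulus

section Homogeneity

theorem eval_smul_of_isHomogeneous {R σ : Type*} [CommSemiring R] {P : MvPolynomial σ R} {d : ℕ}
    (hP : P.IsHomogeneous d) (r : R) (v : σ → R) :
    MvPolynomial.eval (r • v) P = r ^ d * MvPolynomial.eval v P := by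
  rw [MvPolynomial.eval_eq, MvPolynomial.eval_eq, Finset.mul_sum]
  refine Finset.sum_congr rfl fun e he => ?_
  have hd : ∑ i ∈ e.support, e i = d := by
    rw [← hP (MvPolynomial.mem_support_iff.1 he)]
    exact DFunLike.congr_fun Finsupp.degree_eq_weight_one e
  simp only [Pi.smul_apply, smul_eq_mul, mul_pow, Finset.prod_mul_distrib]
  rw [Finset.prod_pow_eq_pow_sum, hd]
  ring

theorem exists_forall_norm_pow_comparable {E : Type*} [NormedAddCommGroup E] [NormedSpace ℝ E]
    [ProperSpace E] {f : E → ℝ} {k : ℕ} (hf : Continuous f)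
    (hhom : ∀ (r : ℝ) v, f (r • v) = r ^ k * f v) (hf0 : ∀ v, v ≠ 0 → f v ≠ 0) :
    ∃ Γ : ℝ, 1 ≤ Γ ∧ ∀ v, v ≠ 0 → Γ⁻¹ * ‖v‖ ^ k ≤ |f v| ∧ |f v| ≤ Γ * ‖v‖ ^ k := by
  have hne : ∀ v ∈ Metric.sphere (0 : E) 1, f v ≠ 0 := fun v hv =>
    hf0 v (ne_zero_of_mem_unit_sphere ⟨v, hv⟩)
  obtain ⟨b, hb⟩ := (isCompact_sphere (0 : E) 1).exists_bound_of_continuousOn hf.continuousOn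
  obtain ⟨b', hb'⟩ := (isCompact_sphere (0 : E) 1).exists_bound_of_continuousOn
    (hf.continuousOn.inv₀ hne)
  refine ⟨max 1 (max b b'), le_max_left _ _, fun v hv => ?_⟩
  have hv0 : 0 < ‖v‖ := norm_pos_iff.2 hv
  have hmem : ‖v‖⁻¹ • v ∈ Metric.sphere (0 : E) 1 := by
    simp [norm_smul, hv0.ne']
  have hscale : |f v| = |f (‖v‖⁻¹ • v)| * ‖v‖ ^ k := by
    rw [hhom, abs_mul, abs_pow, abs_inv, abs_norm, inv_pow, mul_comm (_⁻¹),
      inv_mul_cancel_right₀ (pow_pos hv0 k).ne']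
  rw [hscale]
  have hpos : 0 < |f (‖v‖⁻¹ • v)| := abs_pos.2 (hne _ hmem)
  have hlow : |f (‖v‖⁻¹ • v)|⁻¹ ≤ max 1 (max b b') := by
    simpa only [Pi.inv_apply, norm_inv, Real.norm_eq_abs] using
      (hb' _ hmem).trans ((le_max_right _ _).trans (le_max_right _ _))
  have hupp : |f (‖v‖⁻¹ • v)| ≤ max 1 (max b b') :=
    (hb _ hmem).trans ((le_max_left _ _).trans (le_max_right _ _))
  have := inv_le_of_inv_le₀ hpos hlow
  constructor <;> gcongr

theorem rpow_le_mul_rpow_of_comparable {q t Γ p : ℝ} (hΓ : 1 ≤ Γ) (ht : 0 < t)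
    (hlow : Γ⁻¹ * t ≤ q) (hupp : q ≤ Γ * t) : q ^ p ≤ Γ ^ |p| * t ^ p := by
  have hΓ0 : 0 < Γ := by positivity
  have hq : 0 < q := lt_of_lt_of_le (by positivity) hlow
  rcases le_total 0 p with hp | hp
  · calc q ^ p ≤ (Γ * t) ^ p := Real.rpow_le_rpow hq.le hupp hp
      _ = Γ ^ |p| * t ^ p := by rw [Real.mul_rpow hΓ0.le ht.le, abs_of_nonneg hp]
  · calc q ^ p ≤ (Γ⁻¹ * t) ^ p := Real.rpow_le_rpow_of_nonpos (by positivity) hlow hp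
      _ = Γ ^ |p| * t ^ p := by
        rw [Real.mul_rpow (by positivity) ht.le, Real.inv_rpow hΓ0.le, ← Real.rpow_neg hΓ0.le,
          abs_of_nonpos hp]

variable {m n : ℕ}

theorem polyEval_smul {P : MvPolynomial (Fin m ⊕ Fin n) ℝ} {d : ℕ}
    (hP : P.IsHomogeneous d) (r : ℝ) (x : Fin m → ℝ) (y : Fin n → ℝ) :
    polyEval P (r • x) (r • y) = r ^ d * polyEval P x y := by
  have hsmul : Sum.elim (r • x) (r • y) = r • Sum.elim x y := by
    ext k
    cases k <;> rfl
  rw [polyEval, hsmul, eval_smul_of_isHomogeneous hP, polyEval]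

theorem measurable_dampedKernel (S D : MvPolynomial (Fin m ⊕ Fin n) ℝ)
    {φ : (Fin m → ℝ) × (Fin n → ℝ) → ℂ} (hφ : Measurable φ) (lam : ℝ) (z : ℂ) :
    Measurable (Function.uncurry (dampedKernel S D φ lam z)) :=
  measurable_dampedDensity (continuous_polyEval S).measurable (continuous_polyEval D).measurable
    hφ lam z

theorem norm_dampedKernel (S : MvPolynomial (Fin m ⊕ Fin n) ℝ)
    {D : MvPolynomial (Fin m ⊕ Fin n) ℝ} (φ : (Fin m → ℝ) × (Fin n → ℝ) → ℂ) (lam : ℝ) (z : ℂ)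
    {x : Fin m → ℝ} {y : Fin n → ℝ} (hD : polyEval D x y ≠ 0) :
    ‖dampedKernel S D φ lam z x y‖ = |polyEval D x y| ^ z.re * ‖φ (x, y)‖ := by
  rw [dampedKernel, norm_mul, norm_mul, norm_cexp_I_mul_ofReal, one_mul,
    Complex.norm_cpow_eq_rpow_re_of_pos (abs_pos.2 hD)]

theorem exists_norm_dampedKernel_le (S : MvPolynomial (Fin m ⊕ Fin n) ℝ)
    {D : MvPolynomial (Fin m ⊕ Fin n) ℝ} {dD : ℕ} (hD : D.IsHomogeneous dD)
    (hDnv : NonvanishingAwayFromOrigin D) (σ : ℝ) :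
    ∃ C : ℝ, 0 < C ∧ ∀ (φ : (Fin m → ℝ) × (Fin n → ℝ) → ℂ) (lam : ℝ) (z : ℂ), |z.re| ≤ σ →
      ∀ x y, (x, y) ≠ 0 →
        ‖dampedKernel S D φ lam z x y‖ ≤ C * ‖(x, y)‖ ^ (dD * z.re) * ‖φ (x, y)‖ := by
  obtain ⟨Γ, hΓ, hcomp⟩ := exists_forall_norm_pow_comparable (continuous_polyEval D)
    (fun r v => polyEval_smul hD r v.1 v.2) fun v => hDnv.polyEval_ne_zero
  refine ⟨Γ ^ σ, by positivity, fun φ lam z hz x y hxy => ?_⟩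
  obtain ⟨hlow, hupp⟩ := hcomp _ hxy
  rw [norm_dampedKernel S φ lam z (hDnv.polyEval_ne_zero hxy), Real.rpow_mul (norm_nonneg _),
    Real.rpow_natCast]
  gcongr
  calc |polyEval D x y| ^ z.re ≤ Γ ^ |z.re| * (‖(x, y)‖ ^ dD) ^ z.re :=
        rpow_le_mul_rpow_of_comparable hΓ (pow_pos (norm_pos_iff.2 hxy) _) hlow hupp
    _ ≤ Γ ^ σ * (‖(x, y)‖ ^ dD) ^ z.re := by gcongr

theorem exists_kernelNormLE_size (hm : 0 < m) (hn : 0 < n)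
    (S : MvPolynomial (Fin m ⊕ Fin n) ℝ) {D : MvPolynomial (Fin m ⊕ Fin n) ℝ}
    {dD : ℕ} (hD : D.IsHomogeneous dD) (hDnv : NonvanishingAwayFromOrigin D) (σ : ℝ) :
    ∃ C : ℝ, 0 < C ∧ ∀ (φ : (Fin m → ℝ) × (Fin n → ℝ) → ℂ) (F ρ lam : ℝ) (z : ℂ),
      Measurable φ → (∀ v, ‖φ v‖ ≤ F) → (∀ v, ρ < ‖v‖ → φ v = 0) → 0 < ρ → |z.re| ≤ σ →
      0 ≤ dD * z.re + ((m : ℝ) + n) / 2 →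
      KernelNormLE (dampedKernel S D φ lam z) (C * F * ρ ^ (dD * z.re + ((m : ℝ) + n) / 2)) := by
  obtain ⟨Γ, hΓ, hpt⟩ := exists_norm_dampedKernel_le S hD hDnv σ
  obtain ⟨C, hC, hbound⟩ := exists_kernelNormLE_of_norm_le hm hn
  refine ⟨C * Γ, by positivity, fun φ F ρ lam z hφ hφF hφρ hρ hz hγ => ?_⟩
  have hF : 0 ≤ F := (norm_nonneg _).trans (hφF 0)
  set γ := dD * z.re + ((m : ℝ) + n) / 2 with hγdef
  rw [show C * Γ * F * ρ ^ γ = C * (Γ * F * ρ ^ γ) by ring]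
  refine hbound _ _ (by positivity) (measurable_dampedKernel S D hφ lam z) fun x y hx => ?_
  have hxy : (x, y) ≠ 0 := fun h => hx (congrArg Prod.fst h)
  rw [← Prod.norm_mk]
  have hv : 0 < ‖(x, y)‖ := norm_pos_iff.2 hxy
  rcases lt_or_ge ρ ‖(x, y)‖ with hout | hin
  · rw [dampedKernel, hφρ _ hout, mul_zero, norm_zero]
    positivity
  · calc ‖dampedKernel S D φ lam z x y‖
        ≤ Γ * ‖(x, y)‖ ^ (dD * z.re) * F := by grw [hpt φ lam z hz x y hxy, hφF]
      _ = Γ * F * ‖(x, y)‖ ^ γ * ‖(x, y)‖ ^ (-(((m : ℝ) + n) / 2)) := by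
        rw [mul_assoc (Γ * F), ← Real.rpow_add hv, hγdef, add_neg_cancel_right]
        ring
      _ ≤ Γ * F * ρ ^ γ * ‖(x, y)‖ ^ (-(((m : ℝ) + n) / 2)) := by gcongr

end Homogeneity

section DyadicDecomposition

theorem exists_dyadic_partition (E : Type*) [NormedAddCommGroup E] [NormedSpace ℝ E]
    [HasContDiffBump E] :
    ∃ χ η : E → ℂ, ContDiff ℝ ∞ χ ∧ Continuous η ∧
      (∀ v ∉ Metric.closedBall 0 2 \ Metric.ball 0 (1 / 2), χ v = 0) ∧
      (∀ v, ‖η v‖ ≤ 1) ∧ (∀ v, 2 < ‖v‖ → η v = 0) ∧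
      ∀ R > 0, ∀ v, ‖v‖ ≤ R → ∀ N : ℕ,
        ∑ k ∈ Finset.range N, χ ((R / 2 ^ k)⁻¹ • v) + η ((R / 2 ^ N)⁻¹ • v) = 1 := by
  let B : ContDiffBump (0 : E) := ⟨1, 2, one_pos, one_lt_two⟩
  let η : E → ℂ := fun v => (B v : ℂ)
  have hη : ContDiff ℝ ∞ η := Complex.ofRealCLM.contDiff.comp B.contDiff
  have hη1 : ∀ v, ‖v‖ ≤ 1 → η v = 1 := fun v hv => by
    simp only [η, B.one_of_mem_closedBall (mem_closedBall_zero_iff.2 hv), Complex.ofReal_one]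
  have hη0 : ∀ v, 2 ≤ ‖v‖ → η v = 0 := fun v hv => by
    simp only [η, B.zero_of_le_dist ((dist_zero_right v).symm ▸ hv), Complex.ofReal_zero]
  have htwo : ∀ v : E, ‖(2 : ℝ) • v‖ = 2 * ‖v‖ := fun v => by
    rw [norm_smul, Real.norm_of_nonneg zero_le_two]
  refine ⟨fun v => η v - η ((2 : ℝ) • v), η, hη.sub (hη.comp (contDiff_const_smul _)),
    hη.continuous, fun v hv => ?_, fun v => ?_, fun v hv => hη0 v hv.le, fun R hR v hv N => ?_⟩
  · rw [Set.mem_sdiff, mem_closedBall_zero_iff, mem_ball_zero_iff, not_and_or, not_not,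
      not_le] at hv
    change η v - η ((2 : ℝ) • v) = 0
    rcases hv with hv | hv
    · rw [hη0 v hv.le, hη0 _ (by rw [htwo]; linarith), sub_zero]
    · rw [hη1 v (by linarith), hη1 _ (by rw [htwo]; linarith), sub_self]
  · rw [Complex.norm_real, Real.norm_of_nonneg B.nonneg]
    exact B.le_one
  · have hstep : ∀ k : ℕ, (2 : ℝ) • (R / 2 ^ k)⁻¹ • v = (R / 2 ^ (k + 1))⁻¹ • v := fun k => by
      rw [smul_smul]
      congr 1
      field_simp
      ring
    have hfirst : η (R⁻¹ • v) = 1 := hη1 _ <| by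
      rwa [norm_smul, norm_inv, Real.norm_of_nonneg hR.le, inv_mul_le_iff₀ hR, mul_one]
    simp only [hstep]
    rw [Finset.sum_range_sub' fun k => η ((R / 2 ^ k)⁻¹ • v), pow_zero, div_one, hfirst]
    ring

variable {m n : ℕ}

theorem dampedKernel_smul {S D : MvPolynomial (Fin m ⊕ Fin n) ℝ} {d dD : ℕ}
    (hS : S.IsHomogeneous d) (hD : D.IsHomogeneous dD) {r : ℝ} (hr : 0 < r)
    (φ : (Fin m → ℝ) × (Fin n → ℝ) → ℂ) (lam : ℝ) (z : ℂ) (x : Fin m → ℝ) (y : Fin n → ℝ) :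
    dampedKernel S D φ lam z (r • x) (r • y) = ((r ^ dD : ℝ) : ℂ) ^ z *
      dampedKernel S D (fun v => φ (r • v)) (lam * r ^ d) z x y := by
  unfold dampedKernel
  rw [polyEval_smul hS, polyEval_smul hD, abs_mul, abs_of_pos (pow_pos hr dD),
    Complex.ofReal_mul (r ^ dD), Complex.mul_cpow_ofReal_nonneg (pow_pos hr dD).le (abs_nonneg _),
    mul_assoc lam]
  simp only [Prod.smul_mk]
  ring

theorem KernelNormLE.of_smul_amplitude {S D : MvPolynomial (Fin m ⊕ Fin n) ℝ} {d dD : ℕ}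
    (hS : S.IsHomogeneous d) (hD : D.IsHomogeneous dD) {r : ℝ} (hr : 0 < r)
    {φ : (Fin m → ℝ) × (Fin n → ℝ) → ℂ} {lam : ℝ} {z : ℂ} {A : ℝ}
    (h : KernelNormLE (dampedKernel S D (fun v => φ (r • v)) (lam * r ^ d) z) A) :
    KernelNormLE (dampedKernel S D φ lam z) (r ^ (dD * z.re + ((m : ℝ) + n) / 2) * A) := by
  have hscaled : KernelNormLE (fun x y => dampedKernel S D φ lam z (r • x) (r • y))
      (r ^ (dD * z.re) * A) := by
    have hfactor : ‖((r ^ dD : ℝ) : ℂ) ^ z‖ = r ^ (dD * z.re) := by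
      rw [Complex.norm_cpow_eq_rpow_re_of_pos (pow_pos hr dD), Real.rpow_mul hr.le,
        Real.rpow_natCast]
    simpa only [dampedKernel_smul hS hD hr, hfactor] using h.const_mul (((r ^ dD : ℝ) : ℂ) ^ z)
  rw [Real.rpow_add hr, mul_comm (r ^ (dD * z.re)), mul_assoc]
  exact KernelNormLE.of_comp_smul hr hscaled

variable {S D : MvPolynomial (Fin m ⊕ Fin n) ℝ} {d dD : ℕ}
  {φ : (Fin m → ℝ) × (Fin n → ℝ) → ℂ}

theorem exists_kernelNormLE_dyadic (hSd : S.IsHomogeneous d) (hS : RankOne S)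
    (hD : D.IsHomogeneous dD) (hDnv : NonvanishingAwayFromOrigin D)
    {K : Set ((Fin m → ℝ) × (Fin n → ℝ))} (hK : IsCompact K) (hK0 : 0 ∉ K)
    {χ : (Fin m → ℝ) × (Fin n → ℝ) → ℂ} (hχ : ContDiff ℝ 2 χ) (hχK : ∀ v ∉ K, χ v = 0)
    (hφ : ContDiff ℝ 2 φ) (R σ : ℝ) :
    ∃ C : ℝ, 0 ≤ C ∧ ∀ r : ℝ, 0 < r → r ≤ R → ∀ lam : ℝ, lam ≠ 0 → ∀ z : ℂ, |z.re| ≤ σ →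
      KernelNormLE (dampedKernel S D (fun v => φ v * χ (r⁻¹ • v)) lam z)
        (C * (1 + ‖z‖) ^ 2 * (|lam| ^ (-(1 / 2) : ℝ) *
          r ^ (dD * z.re - ((d : ℝ) - m - n) / 2))) := by
  have hh : ContDiff ℝ 2 fun q : ℝ × (Fin m → ℝ) × (Fin n → ℝ) => φ (q.1 • q.2) * χ q.2 :=
    (hφ.comp (contDiff_fst.smul contDiff_snd)).mul (hχ.comp contDiff_snd)
  obtain ⟨C, hC, hann⟩ := exists_kernelNormLE_annulus hS hDnv hK hK0 (isCompact_Icc (a := 0)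
    (b := R)) hh (fun r v hv => by simp only [hχK v hv, mul_zero]) σ
  refine ⟨C, hC, fun r hr hrR lam hlam z hz => ?_⟩
  have hrd : 0 < r ^ d := pow_pos hr d
  have hunit := hann r ⟨hr.le, hrR⟩ (lam * r ^ d) (mul_ne_zero hlam hrd.ne') z hz
  refine (KernelNormLE.of_smul_amplitude (φ := fun v => φ v * χ (r⁻¹ • v)) hSd hD hr
    (by simpa only [inv_smul_smul₀ hr.ne'] using hunit)).mono (le_of_eq ?_)
  have hexp : r ^ (dD * z.re - ((d : ℝ) - m - n) / 2) =
      r ^ (dD * z.re + ((m : ℝ) + n) / 2) * (r ^ d) ^ (-(1 / 2) : ℝ) := by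
    rw [← Real.rpow_natCast, ← Real.rpow_mul hr.le, ← Real.rpow_add hr]
    ring_nf
  rw [abs_mul, abs_of_pos hrd, Real.mul_rpow (abs_nonneg _) hrd.le, hexp]
  ring

theorem exists_kernelNormLE_remainder (hm : 0 < m) (hn : 0 < n)
    (S : MvPolynomial (Fin m ⊕ Fin n) ℝ) (hD : D.IsHomogeneous dD)
    (hDnv : NonvanishingAwayFromOrigin D) {η : (Fin m → ℝ) × (Fin n → ℝ) → ℂ}
    (hη : Continuous η) (hη1 : ∀ v, ‖η v‖ ≤ 1) (hη0 : ∀ v, 2 < ‖v‖ → η v = 0)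
    (hφ : Continuous φ) (hφc : HasCompactSupport φ) (σ : ℝ) :
    ∃ C : ℝ, 0 ≤ C ∧ ∀ r : ℝ, 0 < r → ∀ (lam : ℝ) (z : ℂ), |z.re| ≤ σ →
      0 ≤ dD * z.re + ((m : ℝ) + n) / 2 →
      KernelNormLE (dampedKernel S D (fun v => φ v * η (r⁻¹ • v)) lam z)
        (C * r ^ (dD * z.re + ((m : ℝ) + n) / 2)) := by
  obtain ⟨F, hF⟩ := hφ.bounded_above_of_compact_support hφc
  have hF0 : 0 ≤ F := (norm_nonneg _).trans (hF 0)
  obtain ⟨C, hC, hsize⟩ := exists_kernelNormLE_size hm hn S hD hDnv σ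
  refine ⟨C * F * 2 ^ (dD * σ + ((m : ℝ) + n) / 2), by positivity, fun r hr lam z hz hγ => ?_⟩
  have hamp : ∀ v, ‖φ v * η (r⁻¹ • v)‖ ≤ F := fun v => by
    rw [norm_mul]
    exact (mul_le_of_le_one_right (norm_nonneg _) (hη1 _)).trans (hF v)
  have hsupp : ∀ v, 2 * r < ‖v‖ → φ v * η (r⁻¹ • v) = 0 := fun v hv => by
    rw [hη0, mul_zero]
    rwa [norm_smul, norm_inv, Real.norm_of_nonneg hr.le, lt_inv_mul_iff₀ hr, mul_comm]
  have hmeas : Measurable fun v => φ v * η (r⁻¹ • v) :=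
    (hφ.mul (hη.comp (continuous_const_smul r⁻¹))).measurable
  refine (hsize _ F (2 * r) lam z hmeas hamp hsupp (by positivity) hz hγ).mono ?_
  rw [Real.mul_rpow zero_le_two hr.le, ← mul_assoc]
  gcongr
  · exact one_le_two
  · exact (le_abs_self _).trans hz

theorem exists_kernelNormLE_dampedKernel (hm : 0 < m) (hn : 0 < n) (hSd : S.IsHomogeneous d)
    (hS : RankOne S) (hD : D.IsHomogeneous dD) (hDnv : NonvanishingAwayFromOrigin D)
    (hφ : ContDiff ℝ 2 φ) (hφc : HasCompactSupport φ) (σ : ℝ) :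
    ∃ C R : ℝ, 0 ≤ C ∧ 1 ≤ R ∧ ∀ lam : ℝ, lam ≠ 0 → ∀ z : ℂ, |z.re| ≤ σ →
      0 ≤ dD * z.re + ((m : ℝ) + n) / 2 → ∀ N : ℕ,
      KernelNormLE (dampedKernel S D φ lam z) (C * (1 + ‖z‖) ^ 2 *
        (|lam| ^ (-(1 / 2) : ℝ) *
          ∑ k ∈ Finset.range N, (R / 2 ^ k) ^ (dD * z.re - ((d : ℝ) - m - n) / 2) +
        (R / 2 ^ N) ^ (dD * z.re + ((m : ℝ) + n) / 2))) := by
  obtain ⟨R, hR1, hφR⟩ : ∃ R : ℝ, 1 ≤ R ∧ ∀ v, R < ‖v‖ → φ v = 0 := by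
    obtain ⟨R, -, hR⟩ := hφc.isCompact.isBounded.exists_pos_norm_le
    refine ⟨max 1 R, le_max_left _ _, fun v hv => image_eq_zero_of_notMem_tsupport fun h => ?_⟩
    exact hv.not_ge ((hR v h).trans (le_max_right _ _))
  have hR0 : 0 < R := by positivity
  obtain ⟨χ, η, hχ, hη, hχ0, hη1, hη0, hsum⟩ :=
    exists_dyadic_partition ((Fin m → ℝ) × (Fin n → ℝ))
  obtain ⟨C₁, hC₁, hpiece⟩ := exists_kernelNormLE_dyadic hSd hS hD hDnv
    ((isCompact_closedBall _ _).diff Metric.isOpen_ball) (by simp) (hχ.of_le ENat.LEInfty.out)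
    hχ0 hφ R σ
  obtain ⟨C₂, hC₂, hrem⟩ := exists_kernelNormLE_remainder hm hn S hD hDnv hη hη1 hη0
    hφ.continuous hφc σ
  refine ⟨C₁ + C₂, R, by positivity, hR1, fun lam hlam z hz hγ N => ?_⟩
  have hdec : dampedKernel S D φ lam z = fun x y =>
      (∑ k ∈ Finset.range N, dampedKernel S D (fun v => φ v * χ ((R / 2 ^ k)⁻¹ • v)) lam z x y) +
      dampedKernel S D (fun v => φ v * η ((R / 2 ^ N)⁻¹ • v)) lam z x y := by
    ext x y
    simp only [dampedKernel, ← Finset.mul_sum, ← mul_add]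
    rcases lt_or_ge R ‖(x, y)‖ with hout | hin
    · rw [hφR _ hout, zero_mul]
    · rw [hsum R hR0 _ hin, mul_one]
  have hβ : ∀ k : ℕ, 0 ≤ (R / 2 ^ k) ^ (dD * z.re - ((d : ℝ) - m - n) / 2) :=
    fun k => by positivity
  rw [hdec]
  refine ((KernelNormLE.sum (Finset.range N) (fun k _ => hpiece (R / 2 ^ k) (by positivity)
    (div_le_self hR0.le (one_le_pow₀ one_le_two)) lam hlam z hz)
    (fun k _ => by have := hβ k; positivity)).add
    (hrem (R / 2 ^ N) (by positivity) lam z hz hγ)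
    (Finset.sum_nonneg fun k _ => by have := hβ k; positivity) (by positivity)).mono ?_
  have hZ : 1 ≤ (1 + ‖z‖) ^ 2 := one_le_pow₀ (by linarith [norm_nonneg z])
  have hC : C₂ ≤ (C₁ + C₂) * (1 + ‖z‖) ^ 2 :=
    (le_add_of_nonneg_left hC₁).trans (le_mul_of_one_le_right (by positivity) hZ)
  have hsum0 := Finset.sum_nonneg fun k (_ : k ∈ Finset.range N) => hβ k
  rw [← Finset.mul_sum, ← Finset.mul_sum, mul_add]
  gcongr
  exact le_add_of_nonneg_right hC₂

end DyadicDecomposition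

section DyadicSums

/-- The quantity `L^{-s} ∑_{k < N} (R 2^{-k})^β + (R 2^{-N})^{β + s}`: a bound `L^{-s} r^β` for each
of the dyadic scales `r = R 2^{-k}`, `k < N`, and the bound `r^{β + s}` for all the smaller ones
together. -/
def dyadicBound (R L s β : ℝ) (N : ℕ) : ℝ :=
  L ^ (-s) * ∑ k ∈ Finset.range N, (R / 2 ^ k) ^ β + (R / 2 ^ N) ^ (β + s)

theorem exists_two_pow_ge_minimal (x : ℝ) : ∃ N : ℕ, x ≤ 2 ^ N ∧ ∀ k < N, 2 ^ k < x := by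
  classical
  have h : ∃ N : ℕ, x ≤ 2 ^ N := (pow_unbounded_of_one_lt x one_lt_two).imp fun _ => le_of_lt
  exact ⟨Nat.find h, Nat.find_spec h, fun k hk => not_le.1 (Nat.find_min h hk)⟩

theorem sum_two_pow_rpow_le {a β : ℝ} (ha : 0 < a) (hβ : β ≤ -a) (N : ℕ) :
    ∑ k ∈ Finset.range N, ((2 : ℝ) ^ k) ^ β ≤ (1 - (2 : ℝ) ^ (-a))⁻¹ := by
  have hq : (2 : ℝ) ^ (-a) < 1 := Real.rpow_lt_one_of_one_lt_of_neg one_lt_two (by linarith)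
  calc ∑ k ∈ Finset.range N, ((2 : ℝ) ^ k) ^ β
      ≤ ∑ k ∈ Finset.range N, ((2 : ℝ) ^ (-a)) ^ k := by
        refine Finset.sum_le_sum fun k _ => ?_
        rw [← Real.rpow_natCast, ← Real.rpow_natCast, ← Real.rpow_mul zero_le_two,
          ← Real.rpow_mul zero_le_two, mul_comm _ (k : ℝ)]
        gcongr
        exact one_le_two
    _ ≤ (1 - (2 : ℝ) ^ (-a))⁻¹ := by
        rw [← tsum_geometric_of_lt_one (by positivity) hq]
        exact (summable_geometric_of_lt_one (by positivity) hq).sum_le_tsum _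
          fun k _ => by positivity

theorem sum_dyadic_rpow_le_of_pos {R a β : ℝ} (hR : 0 < R) (ha : 0 < a) (hβ : a ≤ β) (N : ℕ) :
    ∑ k ∈ Finset.range N, (R / 2 ^ k) ^ β ≤ R ^ β * (1 - (2 : ℝ) ^ (-a))⁻¹ := by
  have hscale : ∀ k : ℕ, (R / 2 ^ k) ^ β = R ^ β * ((2 : ℝ) ^ k) ^ (-β) := fun k => by
    rw [Real.div_rpow hR.le (by positivity), Real.rpow_neg (by positivity), div_eq_mul_inv]
  simp only [hscale, ← Finset.mul_sum]
  gcongr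
  exact sum_two_pow_rpow_le ha (by linarith) N

theorem sum_dyadic_rpow_le_of_neg {R L a β : ℝ} (hR : 0 < R) (hL : 0 < L) (ha : 0 < a)
    (hβ : β ≤ -a) {N : ℕ} (hN : ∀ k < N, 2 ^ k < R * L) :
    ∑ k ∈ Finset.range N, (R / 2 ^ k) ^ β ≤ L ^ (-β) * (1 - (2 : ℝ) ^ (-a))⁻¹ := by
  have hterm : ∀ k ∈ Finset.range N,
      (R / 2 ^ k) ^ β ≤ L ^ (-β) * ((2 : ℝ) ^ (N - 1 - k)) ^ β := fun k hk => by
    have hkN := Finset.mem_range.1 hk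
    have hscale : (R / 2 ^ k) ^ β = L ^ (-β) * (R * L / 2 ^ k) ^ β := by
      rw [mul_div_right_comm, Real.mul_rpow (by positivity) hL.le, mul_left_comm,
        ← Real.rpow_add hL, neg_add_cancel, Real.rpow_zero, mul_one]
    have hlast : (2 : ℝ) ^ (N - 1 - k) ≤ R * L / 2 ^ k := by
      rw [le_div_iff₀ (by positivity), ← pow_add, Nat.sub_add_cancel (by omega)]
      exact (hN (N - 1) (by omega)).le
    rw [hscale]
    exact mul_le_mul_of_nonneg_left
      (Real.rpow_le_rpow_of_nonpos (by positivity) hlast (by linarith)) (by positivity)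
  calc ∑ k ∈ Finset.range N, (R / 2 ^ k) ^ β
      ≤ ∑ k ∈ Finset.range N, L ^ (-β) * ((2 : ℝ) ^ (N - 1 - k)) ^ β := Finset.sum_le_sum hterm
    _ = L ^ (-β) * ∑ k ∈ Finset.range N, ((2 : ℝ) ^ k) ^ β := by
        rw [← Finset.mul_sum, Finset.sum_range_reflect fun k => ((2 : ℝ) ^ k) ^ β]
    _ ≤ L ^ (-β) * (1 - (2 : ℝ) ^ (-a))⁻¹ := by
        gcongr
        exact sum_two_pow_rpow_le ha hβ N

theorem natCast_mul_log_two_le {x : ℝ} (hx : 1 ≤ x) {N : ℕ} (hN : ∀ k < N, 2 ^ k < x) :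
    N * Real.log 2 ≤ Real.log 2 + Real.log x := by
  rcases N with _ | N
  · have := Real.log_nonneg hx
    have := Real.log_nonneg one_le_two
    simp only [Nat.cast_zero, zero_mul]
    positivity
  · have := Real.log_le_log (by positivity) (hN N N.lt_succ_self).le
    rw [Real.log_pow] at this
    push_cast
    linarith

theorem div_two_pow_rpow_le {R L s : ℝ} (hR : 0 < R) (hL : 0 < L) (hs : 0 ≤ s) {N : ℕ}
    (hN : R * L ≤ 2 ^ N) : (R / 2 ^ N) ^ s ≤ L ^ (-s) := by
  rw [Real.rpow_neg hL.le, ← Real.inv_rpow hL.le]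
  refine Real.rpow_le_rpow (by positivity) ?_ hs
  rwa [div_le_iff₀ (by positivity), ← div_eq_inv_mul, le_div_iff₀ hL]

theorem exists_dyadicBound_le_of_pos {R a b s : ℝ} (hR : 1 ≤ R) (ha : 0 < a) (hs : 0 ≤ s) :
    ∃ C, 0 ≤ C ∧ ∀ L β, 0 < L → a ≤ β → β ≤ b →
      ∃ N, dyadicBound R L s β N ≤ C * L ^ (-s) := by
  have hR0 : 0 < R := by positivity
  have hg : 0 ≤ (1 - (2 : ℝ) ^ (-a))⁻¹ := by simpa using sum_two_pow_rpow_le ha le_rfl 0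
  refine ⟨R ^ b * (1 - (2 : ℝ) ^ (-a))⁻¹ + R ^ b, by positivity, fun L β hL haβ hβb => ?_⟩
  obtain ⟨N, hN, -⟩ := exists_two_pow_ge_minimal (R * L)
  have hsum := sum_dyadic_rpow_le_of_pos hR0 ha haβ N
  have hlast : (R / 2 ^ N) ^ β ≤ R ^ β := by
    have := div_le_self hR0.le (one_le_pow₀ (n := N) one_le_two)
    exact Real.rpow_le_rpow (by positivity) this (by linarith)
  have hRb : R ^ β ≤ R ^ b := Real.rpow_le_rpow_of_exponent_le hR hβb
  refine ⟨N, ?_⟩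
  rw [dyadicBound, Real.rpow_add (by positivity)]
  grw [hsum, hlast, div_two_pow_rpow_le hR0 hL hs hN, hRb]
  linarith

theorem exists_dyadicBound_zero_le {R s : ℝ} (hR : 1 ≤ R) (hs : 0 ≤ s) :
    ∃ C, 0 ≤ C ∧ ∀ L X, 0 < L → L ≤ X → 2 ≤ X →
      ∃ N, dyadicBound R L s 0 N ≤ C * (L ^ (-s) * Real.log X) := by
  have hlog2 : 0 < Real.log 2 := Real.log_pos one_lt_two
  have hlogR : 0 ≤ Real.log R := Real.log_nonneg hR
  refine ⟨(3 + Real.log R / Real.log 2) / Real.log 2, by positivity, fun L X hL hLX hX => ?_⟩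
  obtain ⟨N, hN, hmin⟩ := exists_two_pow_ge_minimal (R * L)
  have hR0 : 0 < R := by positivity
  have hX0 : 0 < X := by positivity
  have hlogX : Real.log 2 ≤ Real.log X := Real.log_le_log two_pos hX
  have hcount : N * Real.log 2 ≤ Real.log 2 + (Real.log R + Real.log X) := by
    rw [← Real.log_mul hR0.ne' hX0.ne']
    exact natCast_mul_log_two_le (one_le_mul_of_one_le_of_one_le hR (by linarith))
      fun k hk => (hmin k hk).trans_le (by gcongr)
  have hlogRX : Real.log R ≤ Real.log R / Real.log 2 * Real.log X := by
    rw [div_mul_eq_mul_div, le_div_iff₀ hlog2]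
    gcongr
  have hscales : N + 1 ≤ (3 + Real.log R / Real.log 2) / Real.log 2 * Real.log X := by
    rw [div_mul_eq_mul_div, le_div_iff₀ hlog2]
    linarith
  refine ⟨N, ?_⟩
  calc dyadicBound R L s 0 N = L ^ (-s) * N + (R / 2 ^ N) ^ s := by simp [dyadicBound]
    _ ≤ L ^ (-s) * N + L ^ (-s) := by grw [div_two_pow_rpow_le hR0 hL hs hN]
    _ = L ^ (-s) * (N + 1) := by ring
    _ ≤ L ^ (-s) * ((3 + Real.log R / Real.log 2) / Real.log 2 * Real.log X) := by gcongr
    _ = _ := by ring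

theorem exists_dyadicBound_le_of_neg {R L a β s : ℝ} (hR : 0 < R) (hL : 0 < L) (ha : 0 < a)
    (hβ : β ≤ -a) (hs : 0 ≤ β + s) :
    ∃ N, dyadicBound R L s β N ≤ ((1 - (2 : ℝ) ^ (-a))⁻¹ + 1) * L ^ (-(β + s)) := by
  obtain ⟨N, hN, hmin⟩ := exists_two_pow_ge_minimal (R * L)
  refine ⟨N, ?_⟩
  calc dyadicBound R L s β N
      ≤ L ^ (-s) * (L ^ (-β) * (1 - (2 : ℝ) ^ (-a))⁻¹) + L ^ (-(β + s)) := by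
        unfold dyadicBound
        grw [sum_dyadic_rpow_le_of_neg hR hL ha hβ hmin, div_two_pow_rpow_le hR hL hs hN]
    _ = _ := by
        rw [← mul_assoc, ← Real.rpow_add hL, ← neg_add_rev]
        ring

end DyadicSums

section DampingRanges

variable {m n d dD : ℕ} {S D : MvPolynomial (Fin m ⊕ Fin n) ℝ}
  {φ : (Fin m → ℝ) × (Fin n → ℝ) → ℂ}

theorem RankOne.degree_pos (hm : 0 < m) (hS : RankOne S) (hSd : S.IsHomogeneous d) : 0 < d := by
  refine Nat.pos_of_ne_zero ?_
  rintro rfl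
  have hconst : S = MvPolynomial.C (S.coeff 0) :=
    MvPolynomial.totalDegree_eq_zero_iff_eq_C.1
      ((MvPolynomial.totalDegree_zero_iff_isHomogeneous _).2 hSd)
  have hone : (1 : Fin m → ℝ) = 0 := (hS 1 0 fun i j => by rw [hconst]; simp [polyEval]).1
  exact one_ne_zero (congrFun hone ⟨0, hm⟩)

theorem DampedNormLE.mono {lam : ℝ} {z : ℂ} {A B : ℝ} (h : DampedNormLE S D φ lam z A)
    (hAB : A ≤ B) : DampedNormLE S D φ lam z B :=
  KernelNormLE.mono h hAB

theorem natCast_mul_critExp (m n d : ℕ) (hdD : 0 < dD) :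
    dD * critExp m n d dD = ((d : ℝ) - m - n) / 2 := by
  unfold critExp
  field_simp

theorem rpow_inv_rpow_neg_half {t x : ℝ} (ht : t ≠ 0) (hx : 0 ≤ x) :
    (x ^ t⁻¹) ^ (-(t / 2)) = x ^ (-(1 / 2) : ℝ) := by
  rw [← Real.rpow_mul hx]
  field_simp

theorem exists_dampedNormLE_dyadicBound (hm : 0 < m) (hn : 0 < n) (hdD : 0 < dD)
    (hSd : S.IsHomogeneous d) (hS : RankOne S) (hD : D.IsHomogeneous dD)
    (hDnv : NonvanishingAwayFromOrigin D) (hφ : ContDiff ℝ 2 φ) (hφc : HasCompactSupport φ)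
    (σ : ℝ) :
    ∃ C R : ℝ, 0 ≤ C ∧ 1 ≤ R ∧ ∀ (lam : ℝ) (z : ℂ), lam ≠ 0 → |z.re| ≤ σ →
      0 ≤ dD * (z.re - critExp m n d dD) + (d : ℝ) / 2 → ∀ N : ℕ,
      DampedNormLE S D φ lam z (C * (1 + ‖z‖) ^ 2 *
        dyadicBound R (|lam| ^ (d : ℝ)⁻¹) (d / 2) (dD * (z.re - critExp m n d dD)) N) := by
  obtain ⟨C, R, hC, hR, hbound⟩ :=
    exists_kernelNormLE_dampedKernel hm hn hSd hS hD hDnv hφ hφc σ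
  have hd : (0 : ℝ) < d := by exact_mod_cast hS.degree_pos hm hSd
  refine ⟨C, R, hC, hR, fun lam z hlam hz hγ N => ?_⟩
  have hβ : dD * (z.re - critExp m n d dD) = dD * z.re - ((d : ℝ) - m - n) / 2 := by
    rw [mul_sub, natCast_mul_critExp m n d hdD]
  have hγ' : dD * z.re - ((d : ℝ) - m - n) / 2 + d / 2 = dD * z.re + ((m : ℝ) + n) / 2 := by ring
  rw [hβ, hγ'] at hγ
  rw [dyadicBound, hβ, hγ', rpow_inv_rpow_neg_half hd.ne' (abs_nonneg lam)]
  exact hbound lam hlam z hz hγ N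

theorem exists_dampedNormLE_of_critExp_add_le (hm : 0 < m) (hn : 0 < n) (hdD : 0 < dD)
    (hSd : S.IsHomogeneous d) (hS : RankOne S) (hD : D.IsHomogeneous dD)
    (hDnv : NonvanishingAwayFromOrigin D) (hφ : ContDiff ℝ 2 φ) (hφc : HasCompactSupport φ)
    {δ : ℝ} (hδ : 0 < δ) (M : ℝ) :
    ∃ C : ℝ, 0 ≤ C ∧ ∀ (lam : ℝ) (z : ℂ), lam ≠ 0 → critExp m n d dD + δ ≤ z.re → z.re ≤ M →
      DampedNormLE S D φ lam z (C * (1 + ‖z‖) ^ 2 * |lam| ^ (-(1 / 2) : ℝ)) := by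
  obtain ⟨C, R, hC, hR, hdyadic⟩ := exists_dampedNormLE_dyadicBound hm hn hdD hSd hS hD hDnv hφ hφc
    (max |critExp m n d dD + δ| |M|)
  have ha : 0 < dD * δ := by positivity
  have hd : (0 : ℝ) < d := by exact_mod_cast hS.degree_pos hm hSd
  obtain ⟨K, hK, hsum⟩ := exists_dyadicBound_le_of_pos (b := dD * (M - critExp m n d dD)) hR ha
    (show (0 : ℝ) ≤ d / 2 by positivity)
  refine ⟨C * K, by positivity, fun lam z hlam hlow hup => ?_⟩
  have hβ : dD * δ ≤ dD * (z.re - critExp m n d dD) := by gcongr; linarith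
  obtain ⟨N, hN⟩ := hsum (|lam| ^ (d : ℝ)⁻¹) _ (by positivity) hβ (by gcongr)
  refine (hdyadic lam z hlam (abs_le_max_abs_abs hlow hup) (by linarith) N).mono ?_
  grw [hN, rpow_inv_rpow_neg_half hd.ne' (abs_nonneg lam)]
  exact le_of_eq (by ring)

theorem exists_dampedNormLE_of_eq_critExp (hm : 0 < m) (hn : 0 < n) (hdD : 0 < dD)
    (hSd : S.IsHomogeneous d) (hS : RankOne S) (hD : D.IsHomogeneous dD)
    (hDnv : NonvanishingAwayFromOrigin D) (hφ : ContDiff ℝ 2 φ) (hφc : HasCompactSupport φ) :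
    ∃ C : ℝ, 0 ≤ C ∧ ∀ (lam : ℝ) (z : ℂ), lam ≠ 0 → z.re = critExp m n d dD →
      DampedNormLE S D φ lam z
        (C * (1 + ‖z‖) ^ 2 * (|lam| ^ (-(1 / 2) : ℝ) * Real.log (2 + |lam|))) := by
  obtain ⟨C, R, hC, hR, hdyadic⟩ := exists_dampedNormLE_dyadicBound hm hn hdD hSd hS hD hDnv hφ hφc
    |critExp m n d dD|
  have hd : 0 < d := hS.degree_pos hm hSd
  obtain ⟨K, hK, hsum⟩ := exists_dyadicBound_zero_le hR (show (0 : ℝ) ≤ d / 2 by positivity)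
  refine ⟨C * K, by positivity, fun lam z hlam hz => ?_⟩
  have hβ : dD * (z.re - critExp m n d dD) = 0 := by rw [hz, sub_self, mul_zero]
  have hL : |lam| ^ (d : ℝ)⁻¹ ≤ 2 + |lam| := calc
    |lam| ^ (d : ℝ)⁻¹ ≤ (2 + |lam|) ^ (d : ℝ)⁻¹ := by
      gcongr
      linarith
    _ ≤ 2 + |lam| := Real.rpow_le_self_of_one_le (by linarith [abs_nonneg lam])
      (inv_le_one_of_one_le₀ (by exact_mod_cast hd))
  obtain ⟨N, hN⟩ := hsum _ _ (by positivity) hL (by linarith [abs_nonneg lam])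
  refine (hdyadic lam z hlam (by rw [hz]) (by rw [hβ]; positivity) N).mono ?_
  grw [hβ, hN, rpow_inv_rpow_neg_half (by positivity) (abs_nonneg lam)]
  exact le_of_eq (by ring)

theorem exists_dampedNormLE_of_le_critExp_sub (hm : 0 < m) (hn : 0 < n) (hdD : 0 < dD)
    (hSd : S.IsHomogeneous d) (hS : RankOne S) (hD : D.IsHomogeneous dD)
    (hDnv : NonvanishingAwayFromOrigin D) (hφ : ContDiff ℝ 2 φ) (hφc : HasCompactSupport φ)
    {δ : ℝ} (hδ : 0 < δ) :
    ∃ C : ℝ, 0 ≤ C ∧ ∀ (lam : ℝ) (z : ℂ), lam ≠ 0 → -(((m : ℝ) + n) / (2 * dD)) ≤ z.re →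
      z.re ≤ critExp m n d dD - δ →
      DampedNormLE S D φ lam z (C * (1 + ‖z‖) ^ 2 *
        |lam| ^ (-((dD : ℝ) / d) * z.re - ((m : ℝ) + n) / (2 * d))) := by
  obtain ⟨C, R, hC, hR, hdyadic⟩ := exists_dampedNormLE_dyadicBound hm hn hdD hSd hS hD hDnv hφ hφc
    (max |-(((m : ℝ) + n) / (2 * dD))| |critExp m n d dD - δ|)
  have hd : 0 < d := hS.degree_pos hm hSd
  have ha : 0 < dD * δ := by positivity
  have hg : 0 ≤ (1 - (2 : ℝ) ^ (-(dD * δ)))⁻¹ := by simpa using sum_two_pow_rpow_le ha le_rfl 0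
  refine ⟨C * ((1 - (2 : ℝ) ^ (-(dD * δ)))⁻¹ + 1), by positivity, fun lam z hlam hlow hup => ?_⟩
  have hβ : dD * (z.re - critExp m n d dD) ≤ -(dD * δ) := by
    rw [← mul_neg]
    gcongr
    linarith
  have hγ : dD * (z.re - critExp m n d dD) + d / 2 =
      dD * (z.re - -(((m : ℝ) + n) / (2 * dD))) := by
    rw [mul_sub, natCast_mul_critExp m n d hdD]
    field_simp
    ring
  have hγ0 : 0 ≤ dD * (z.re - critExp m n d dD) + (d : ℝ) / 2 := by
    rw [hγ]
    exact mul_nonneg dD.cast_nonneg (sub_nonneg.2 hlow)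
  have htarget : (|lam| ^ (d : ℝ)⁻¹) ^ (-(dD * (z.re - critExp m n d dD) + (d : ℝ) / 2)) =
      |lam| ^ (-((dD : ℝ) / d) * z.re - ((m : ℝ) + n) / (2 * d)) := by
    rw [← Real.rpow_mul (abs_nonneg lam), hγ]
    congr 1
    field_simp
    ring
  obtain ⟨N, hN⟩ := exists_dyadicBound_le_of_neg (R := R) (L := |lam| ^ (d : ℝ)⁻¹) (by positivity)
    (by positivity) ha hβ hγ0
  refine (hdyadic lam z hlam (abs_le_max_abs_abs hlow hup) hγ0 N).mono ?_
  grw [hN, htarget]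
  exact le_of_eq (by ring)

theorem neg_add_div_two_mul_lt_of_neg_min_div_lt (m n : ℕ) (hdD : 0 < dD) {t : ℝ}
    (ht : -((min m n : ℕ) : ℝ) / dD < t) : -(((m : ℝ) + n) / (2 * dD)) < t := by
  refine lt_of_le_of_lt ?_ ht
  have hmin : 2 * ((min m n : ℕ) : ℝ) ≤ m + n := by exact_mod_cast (by omega : 2 * min m n ≤ m + n)
  rw [neg_div, neg_le_neg_iff, div_le_div_iff₀ (by positivity) (by positivity)]
  nlinarith [(dD.cast_nonneg : (0 : ℝ) ≤ dD)]

end DampingRanges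

end DampedOIO

end

theorem theorem3p2_general (nX nY d dD : ℕ) (hnX : 0 < nX) (hnY : 0 < nY) (hdD : 0 < dD)
    (S D : MvPolynomial (Fin nX ⊕ Fin nY) ℝ)
    (hS : S.IsHomogeneous d) (hSrank : DampedOIO.RankOne S)
    (hD : D.IsHomogeneous dD) (hDnv : DampedOIO.NonvanishingAwayFromOrigin D)
    (φ : (Fin nX → ℝ) × (Fin nY → ℝ) → ℂ) (hφ : ContDiff ℝ 2 φ) (hφc : HasCompactSupport φ)
    (δ : ℝ) (hδ : 0 < δ) (M : ℝ) :
    ∃ C : ℝ, 0 < C ∧ ∀ (lam : ℝ) (z : ℂ), lam ≠ 0 →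
      (DampedOIO.critExp nX nY d dD + δ ≤ z.re → z.re ≤ M →
        DampedOIO.DampedNormLE S D φ lam z
          (C * (1 + ‖z‖) ^ 2 * |lam| ^ (-(1 / 2) : ℝ))) ∧
      (z.re = DampedOIO.critExp nX nY d dD →
        DampedOIO.DampedNormLE S D φ lam z
          (C * (1 + ‖z‖) ^ 2 * (|lam| ^ (-(1 / 2) : ℝ) * Real.log (2 + |lam|)))) ∧
      (-(((nX : ℝ) + nY) / (2 * dD)) ≤ z.re → z.re ≤ DampedOIO.critExp nX nY d dD - δ →
        DampedOIO.DampedNormLE S D φ lam z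
          (C * (1 + ‖z‖) ^ 2 *
            |lam| ^ (-((dD : ℝ) / d) * z.re - ((nX : ℝ) + nY) / (2 * d)))) := by
  obtain ⟨C₁, hC₁, habove⟩ := DampedOIO.exists_dampedNormLE_of_critExp_add_le hnX hnY hdD hS
    hSrank hD hDnv hφ hφc hδ M
  obtain ⟨C₂, hC₂, hcritical⟩ := DampedOIO.exists_dampedNormLE_of_eq_critExp hnX hnY hdD hS
    hSrank hD hDnv hφ hφc
  obtain ⟨C₃, hC₃, hbelow⟩ := DampedOIO.exists_dampedNormLE_of_le_critExp_sub hnX hnY hdD hS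
    hSrank hD hDnv hφ hφc hδ
  refine ⟨C₁ + C₂ + C₃ + 1, by positivity, fun lam z hlam => ⟨fun hlow hup => ?_, fun hz => ?_,
    fun hlow hup => ?_⟩⟩
  · refine (habove lam z hlam hlow hup).mono ?_
    gcongr
    linarith
  · refine (hcritical lam z hlam hz).mono ?_
    have : 0 ≤ Real.log (2 + |lam|) := Real.log_nonneg (by linarith [abs_nonneg lam])
    gcongr
    linarith
  · refine (hbelow lam z hlam hlow hup).mono ?_
    gcongr
    linarith

theorem theorem3p2 (nX nY d dD : ℕ) (hnX : 0 < nX) (hnY : 0 < nY)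
    (hd : nX + nY < d) (hdD : 0 < dD)
    (S D : MvPolynomial (Fin nX ⊕ Fin nY) ℝ)
    (hS : S.IsHomogeneous d) (hSrank : DampedOIO.RankOne S)
    (hD : D.IsHomogeneous dD) (hDnv : DampedOIO.NonvanishingAwayFromOrigin D)
    (φ : (Fin nX → ℝ) × (Fin nY → ℝ) → ℂ) (hφ : ContDiff ℝ ∞ φ) (hφc : HasCompactSupport φ)
    (δ : ℝ) (hδ : 0 < δ) (M : ℝ) :
    ∃ C : ℝ, 0 < C ∧ ∀ (lam : ℝ) (z : ℂ), lam ≠ 0 →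
      (DampedOIO.critExp nX nY d dD + δ ≤ z.re → z.re ≤ M →
        DampedOIO.DampedNormLE S D φ lam z
          (C * (1 + ‖z‖) ^ 2 * |lam| ^ (-(1 / 2) : ℝ))) ∧
      (z.re = DampedOIO.critExp nX nY d dD →
        DampedOIO.DampedNormLE S D φ lam z
          (C * (1 + ‖z‖) ^ 2 * (|lam| ^ (-(1 / 2) : ℝ) * Real.log (2 + |lam|)))) ∧
      (-((min nX nY : ℕ) : ℝ) / dD < z.re → z.re ≤ DampedOIO.critExp nX nY d dD - δ →
        DampedOIO.DampedNormLE S D φ lam z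
          (C * (1 + ‖z‖) ^ 2 *
            |lam| ^ (-((dD : ℝ) / d) * z.re - ((nX : ℝ) + nY) / (2 * d)))) := by
  obtain ⟨C, hC, hbound⟩ := theorem3p2_general nX nY d dD hnX hnY hdD S D hS hSrank hD hDnv φ
    (hφ.of_le ENat.LEInfty.out) hφc δ hδ M
  exact ⟨C, hC, fun lam z hlam => (hbound lam z hlam).imp_right <| And.imp_right fun hbelow hlow =>
    hbelow (DampedOIO.neg_add_div_two_mul_lt_of_neg_min_div_lt nX nY hdD hlow).le⟩
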